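/- For an $n\times m$ real matrix $A$ (a dictionary) with columns $A_1,\dots,A_m$, say that $A$ is $(k,\delta)$-RIP if $(1-\delta)\|x\|_2\le\|Ax\|_2\le(1+\delta)\|x\|_2$ for every $x\in\mathbb{R}^m$ with at most $k$ nonzero entries. There exist absolute constants $c_0,c_1,c_2,c_5,c_6>0$ such that the following holds for all integers $1\le n<m$, all integers $k$ with $1\le k<n/\log^{2c_1}m$, and all $q_0\in(0,1]$, $\eta_0\in(0,1)$. Set $\kappa_0:=c_0\,q_0\log^{-c_1}m$, and let $$N\ \ge\ c_2\,k\,n\,m\,\eta_0^{-3}\,q_0^{-1}\,\log^{c_1}m\,\log(1/\kappa_0)$$ be an integer. Then there is an algorithm in exact real arithmetic (a finite algebraic decision tree, depending only on $n,m,k,N,q_0,\eta_0$, with no bound on its running time) which takes $N$ vectors of $\mathbb{R}^n$ as input, outputs an $n\times m$ matrix $\widehat A$, and has the following property. Suppose that - $A\in\mathbb{R}^{n\times m}$ is $(k,\delta)$-RIP for some $\delta<\dfrac{c_5}{\log(1/\kappa_0)\,\log^{c_6}m}$; - $S_1,\dots,S_N\subseteq[m]$ are arbitrary sets of size at most $k$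 such that for all $i_1,i_2,i_3\in[m]$ at least $q_0N$ of the sets $S_r$ contain $i_1,i_2$ and $i_3$; - the samples are $y^{(r)}=Ax^{(r)}$, $r\in[N]$, where $x^{(r)}\in\mathbb{R}^m$ vanishes outside $S_r$ and all the entries $x^{(r)}_i$ ($r\in[N]$, $i\in S_r$) are independent Rademacher variables ($\pm1$ with probability $1/2$ each). Then with probability at least $1-\exp(-n)$ the output $\widehat A$ on $y^{(1)},\dots,y^{(N)}$ satisfies, after a suitable renaming (permutation) of its columns, $\|\widehat A_i-b_iA_i\|_2\le\eta_0$ for all $i\in[m]$ and some signs $b\in\{-1,1\}^m$. -/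

import Mathlib

open MeasureTheory
open scoped Matrix

namespace DictLearning

/-- `(k, δ)`-RIP: `A` preserves the Euclidean norm of every `k`-sparse vector up to a factor
in `[1 - δ, 1 + δ]`. -/
def IsRIP {n m : ℕ} (A : Matrix (Fin n) (Fin m) ℝ) (k : ℕ) (δ : ℝ) : Prop :=
  ∀ x : Fin m → ℝ, (Function.support x).ncard ≤ k →
    (1 - δ) * ‖WithLp.toLp 2 x‖ ≤ ‖WithLp.toLp 2 (A *ᵥ x)‖ ∧
      ‖WithLp.toLp 2 (A *ᵥ x)‖ ≤ (1 + δ) * ‖WithLp.toLp 2 x‖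

/-- The Rademacher distribution: `1` and `-1` with probability `1/2` each. -/
noncomputable def rademacher : Measure ℝ :=
  (2⁻¹ : ENNReal) • Measure.dirac 1 + (2⁻¹ : ENNReal) • Measure.dirac (-1)

instance isProbabilityMeasure_rademacher : IsProbabilityMeasure rademacher :=
  ⟨by simp [rademacher, ENNReal.inv_two_add_inv_two]⟩

/-- The law of one coordinate of the coefficient vector: Rademacher on the support, and `0`
off the support. -/
noncomputable def coordLaw {m : ℕ} (S : Finset (Fin m)) (i : Fin m) : Measure ℝ :=
  if i ∈ S then rademacher else Measure.dirac 0

instance isProbabilityMeasure_coordLaw {m : ℕ} (S : Finset (Fin m)) (i : Fin m) :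
    IsProbabilityMeasure (coordLaw S i) := by
  unfold coordLaw; split <;> infer_instance

/-- The joint law of the coefficient vectors `x⁽¹⁾, …, x⁽ᴺ⁾` with prescribed supports
`S 1, …, S N`: all nonzero values of all the vectors are independent Rademacher variables. -/
noncomputable def coeffLaw {N m : ℕ} (S : Fin N → Finset (Fin m)) :
    Measure (Fin N → Fin m → ℝ) :=
  Measure.pi fun r => Measure.pi fun i => coordLaw (S r) i

instance isProbabilityMeasure_coeffLaw {N m : ℕ} (S : Fin N → Finset (Fin m)) :
    IsProbabilityMeasure (coeffLaw S) := by
  unfold coeffLaw; infer_instance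

/-- The samples `y⁽ʳ⁾ = A x⁽ʳ⁾`, listed coordinate by coordinate. -/
def samples {n m N : ℕ} (A : Matrix (Fin n) (Fin m) ℝ) (x : Fin N → Fin m → ℝ) :
    Fin N × Fin n → ℝ :=
  fun p => (A *ᵥ x p.1) p.2

/-- Algorithms in exact real arithmetic, as (finite) algebraic decision trees: an inner node
evaluates a polynomial in the real inputs and branches on its sign, and a leaf returns
finitely many polynomials in the inputs. The inputs are indexed by `ι` and the outputs
by `κ`. -/
inductive Algorithm (ι κ : Type) : Type
  | output (f : κ → MvPolynomial ι ℝ) : Algorithm ι κ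
  | branch (p : MvPolynomial ι ℝ) (ifNonneg ifNeg : Algorithm ι κ) : Algorithm ι κ

open scoped Classical in
/-- The result of running an algorithm on the input `y`. -/
noncomputable def Algorithm.run {ι κ : Type} (y : ι → ℝ) : Algorithm ι κ → κ → ℝ
  | .output f => fun j => MvPolynomial.eval y (f j)
  | .branch p s t => if 0 ≤ MvPolynomial.eval y p then s.run y else t.run y

/-- The columns of `B` are the columns of `A` up to an error `η` in Euclidean norm, up to
renaming the columns and up to signs. -/
def RecoversColumns {n m : ℕ} (A B : Matrix (Fin n) (Fin m) ℝ) (η : ℝ) : Prop :=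
  ∃ (π : Equiv.Perm (Fin m)) (b : Fin m → ℝ), (∀ i, b i = 1 ∨ b i = -1) ∧
    ∀ i, ‖WithLp.toLp 2 (B.col (π i)) - b i • WithLp.toLp 2 (A.col i)‖ ≤ η

end DictLearning

/-!
The algorithm ignores running time and recovers the dictionary exactly, up to signs and the order of
the columns, so that the accuracy `η₀` plays no role. It searches for an explanation of the samples:
a matrix `X` with entries in `{-1, 0, 1}` and a dictionary `B` with `y⁽ʳ⁾ = B X⁽ʳ⁾` for all but few
samples `r`, where every row of `X` is obtained by rounding the inner products of the samples with one
point of a fine grid in `ℝⁿ` (a *decoder*), and any two rows of `X` often agree and often disagree in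
sign. Given `X`, the dictionary `B` is a fixed linear function of the samples, so that the search is a
finite algebraic decision tree (`exists_search`, `exists_algorithm`).

*The true dictionary is found.* A grid point close to `A i` decodes the `i`-th coefficient with few
errors, by Hoeffding's inequality: the restricted isometry property makes the inner products of `A i`
with the other columns of a support square-summable to at most a multiple of `δ ^ 2`
(`IsRIP.sum_gram_sub_le'`, `prob_decode_le`). This is the only use of the restricted isometry property.

*Nothing else is found.* A grid point `z` acts on a sample with support `S` through the signed sum
`∑ j ∈ S, ± g j` of its weights `g j = ⟨z, A j⟩`. By Chernoff's bound and a union bound over the grid, a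
decoder whose values are close to `0` or `±1` on nearly all samples has this property with probability
close to one over fresh signs, for most supports (`prob_decoder_le`). Reversing signs one at a time
then gives strong information: small weights cannot move the sum from `1` to `-1`
(`Robust.rnd_eq_zero`), at most two weights on a support are large, and a single large weight is close
to `±1` (`lt_abs_of_prob`). As all triples occur together, a support contains all large weights of a
decoder or none of them (`abs_lt_of_regular`). Hence a nonzero decoded value determines the sign of
every coefficient with a large weight, so that two decoders with a common large weight would never both
agree and disagree. The `m` sets of large weights are thus nonempty and disjoint, hence singletons, and
`X` is a signed permutation of the true coefficients outside few samples (`exists_perm_of_decoders`).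

*The dictionary is determined.* Outside few samples `A` and the rearranged `B` agree on the coefficient
vectors, and these span `ℝᵐ` robustly: a union bound over the finitely many vectors modulo `3` shows
that each of them is detected by many samples, and a real vector orthogonal to a set of integer
vectors yields one modulo `3` (`exists_int_ne_zero_mod_three`, `apply_perm_eq_of_explains`).
-/

namespace DictLearning

/-! ### Uniform probability on finite types -/

open scoped Classical in
/-- The probability of the event `P` under the uniform distribution on a finite type. -/
noncomputable def prob {α : Type*} [Fintype α] (P : α → Prop) : ℝ :=
  ((Finset.univ.filter P).card : ℝ) / Fintype.card α

open scoped Classical in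
/-- The number of indices at which `P` holds. -/
noncomputable def count {α : Type*} [Fintype α] (P : α → Prop) : ℝ :=
  ((Finset.univ.filter P).card : ℝ)

section Counting

variable {α β ι : Type*} [Fintype α] [Fintype β] [Fintype ι]

open scoped Classical in
theorem count_eq_sum (P : α → Prop) : count P = ∑ a, if P a then (1 : ℝ) else 0 := by
  simp [count]

theorem count_nonneg (P : α → Prop) : 0 ≤ count P := by unfold count; positivity

theorem count_mono {P Q : α → Prop} (h : ∀ a, P a → Q a) : count P ≤ count Q := by
  classical
  unfold count
  exact_mod_cast Finset.card_le_card (Finset.monotone_filter_right _ (fun a _ => h a))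

theorem count_or_le (P Q : α → Prop) : count (fun a => P a ∨ Q a) ≤ count P + count Q := by
  classical
  unfold count
  refine le_trans (Nat.cast_le.2 (Finset.card_le_card fun a ha => ?_))
    (by exact_mod_cast Finset.card_union_le _ _)
  simpa using ha

theorem count_add_count_not (P : α → Prop) :
    count P + count (fun a => ¬ P a) = Fintype.card α := by
  classical
  unfold count
  rw [← Finset.card_univ]
  have := Finset.card_filter_add_card_filter_not (s := Finset.univ) P
  norm_cast
  convert this

theorem count_exists_le (P : ι → α → Prop) :
    count (fun a => ∃ i, P i a) ≤ ∑ i, count (P i) := by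
  classical
  unfold count
  have h := Finset.card_biUnion_le (s := Finset.univ) (t := fun i => Finset.univ.filter (P i))
  refine le_trans (Nat.cast_le.2 (Finset.card_le_card fun a ha => ?_)) (by exact_mod_cast h)
  simpa using ha

theorem exists_of_count_pos {P : α → Prop} (h : 0 < count P) : ∃ a, P a := by
  classical
  unfold count at h
  obtain ⟨a, ha⟩ := Finset.card_pos.1 (by exact_mod_cast h : 0 < (Finset.univ.filter P).card)
  exact ⟨a, (Finset.mem_filter.1 ha).2⟩

/-- An event that occurs more often than an exceptional event occurs outside of it. -/
theorem exists_and_not_of_count_lt {P Q : α → Prop} (h : count Q < count P) :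
    ∃ a, P a ∧ ¬ Q a := by
  by_contra! hc
  exact absurd (count_mono hc) (not_le.2 h)

theorem prob_eq (P : α → Prop) : prob P = count P / Fintype.card α := rfl

theorem prob_nonneg (P : α → Prop) : 0 ≤ prob P := by unfold prob; positivity

theorem prob_mono {P Q : α → Prop} (h : ∀ a, P a → Q a) : prob P ≤ prob Q :=
  div_le_div_of_nonneg_right (count_mono h) (Nat.cast_nonneg _)

theorem prob_le_one (P : α → Prop) : prob P ≤ 1 := by
  have h := count_add_count_not P
  have := count_nonneg (fun a => ¬ P a)
  exact div_le_one_of_le₀ (by change count P ≤ _; linarith) (Nat.cast_nonneg _)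

theorem prob_or_le (P Q : α → Prop) : prob (fun a => P a ∨ Q a) ≤ prob P + prob Q := by
  rw [prob_eq, prob_eq, prob_eq, ← add_div]
  exact div_le_div_of_nonneg_right (count_or_le P Q) (Nat.cast_nonneg _)

theorem prob_exists_le (P : ι → α → Prop) : prob (fun a => ∃ i, P i a) ≤ ∑ i, prob (P i) := by
  simp only [prob_eq]
  rw [← Finset.sum_div]
  exact div_le_div_of_nonneg_right (count_exists_le P) (Nat.cast_nonneg _)

theorem prob_exists_le_card_mul (P : ι → α → Prop) {c : ℝ} (h : ∀ i, prob (P i) ≤ c) :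
    prob (fun a => ∃ i, P i a) ≤ Fintype.card ι * c := by
  refine (prob_exists_le P).trans ((Finset.sum_le_sum fun i _ => h i).trans ?_)
  simp

theorem prob_add_prob_not [Nonempty α] (P : α → Prop) : prob P + prob (fun a => ¬ P a) = 1 := by
  rw [prob_eq, prob_eq, ← add_div, count_add_count_not]
  have : (Fintype.card α : ℝ) ≠ 0 := by exact_mod_cast Fintype.card_ne_zero
  exact div_self this

theorem prob_comp_equiv (e : α ≃ α) (P : α → Prop) : prob (fun a => P (e a)) = prob P := by
  classical
  rw [prob_eq, prob_eq, count_eq_sum, count_eq_sum,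
    Equiv.sum_comp e (fun a => if P a then (1 : ℝ) else 0)]

theorem exists_of_prob_not_lt_one [Nonempty α] {P : α → Prop} (h : prob (fun a => ¬ P a) < 1) :
    ∃ a, P a := by
  have h1 := prob_add_prob_not P
  have h2 : 0 < prob P := by linarith
  rw [prob_eq] at h2
  by_contra! hc
  have : count P = 0 := by simp [count, hc]
  simp [this] at h2

/-- If a bijection maps the failures of `P` to successes, then `P` has probability at least
one half. -/
theorem half_le_prob_of_equiv [Nonempty α] (e : α ≃ α) {P : α → Prop}
    (h : ∀ a, ¬ P a → P (e a)) : 1 / 2 ≤ prob P := by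
  have h1 := prob_add_prob_not P
  have h2 := (prob_mono h).trans_eq (prob_comp_equiv e P)
  linarith

theorem prob_le_of_exp_moment [Nonempty α] (X : α → ℝ) (t M : ℝ)
    (h : ∑ a, Real.exp (X a) ≤ Fintype.card α * M) :
    prob (fun a => t ≤ X a) ≤ M * Real.exp (-t) := by
  classical
  have hc : (0 : ℝ) < Fintype.card α := by exact_mod_cast Fintype.card_pos
  have h1 : count (fun a => t ≤ X a) * Real.exp t ≤ ∑ a, Real.exp (X a) := by
    rw [count_eq_sum, Finset.sum_mul]
    refine Finset.sum_le_sum fun a _ => ?_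
    split_ifs with ha
    · simpa using ha
    · simp [Real.exp_nonneg]
  rw [prob_eq, div_le_iff₀ hc, Real.exp_neg]
  have := Real.exp_pos t
  field_simp
  linarith

/-- The moment generating function of the number of independent events that occur. -/
theorem sum_exp_count_le (E : ι → α → Prop) (c : ℝ) [Nonempty α] [DecidableEq ι] :
    ∑ ω : ι → α, Real.exp (c * count fun r => E r (ω r)) ≤
      Fintype.card (ι → α) * Real.exp ((Real.exp c - 1) * ∑ r, prob (E r)) := by
  classical
  have hc : (Fintype.card α : ℝ) ≠ 0 := by exact_mod_cast Fintype.card_ne_zero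
  have h1 : ∀ ω : ι → α, Real.exp (c * count fun r => E r (ω r))
      = ∏ r, Real.exp (if E r (ω r) then c else 0) := by
    intro ω
    rw [← Real.exp_sum, count_eq_sum, Finset.mul_sum]
    simp
  have h2 : ∀ r, ∑ v, Real.exp (if E r v then c else 0)
      = Fintype.card α * (1 + (Real.exp c - 1) * prob (E r)) := by
    intro r
    have : ∀ v, Real.exp (if E r v then c else 0)
        = 1 + (Real.exp c - 1) * (if E r v then 1 else 0) := by
      intro v; split_ifs <;> simp
    simp only [this]
    rw [Finset.sum_add_distrib, ← Finset.mul_sum, ← count_eq_sum, prob_eq]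
    field_simp
    simp
  have h3 := Finset.prod_univ_sum (fun _ : ι => (Finset.univ : Finset α))
    (fun r v => Real.exp (if E r v then c else 0))
  rw [Fintype.piFinset_univ] at h3
  simp only [h1]
  rw [← h3]
  simp only [h2]
  rw [Finset.prod_mul_distrib, Finset.mul_sum, Real.exp_sum]
  simp only [Finset.prod_const, Finset.card_univ, Fintype.card_fun, Nat.cast_pow]
  refine mul_le_mul_of_nonneg_left ?_ (by positivity)
  refine Finset.prod_le_prod (fun r _ => ?_) (fun r _ => ?_)
  · have := prob_le_one (E r)
    have := prob_nonneg (E r)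
    have := Real.exp_pos c
    nlinarith
  · have := Real.add_one_le_exp ((Real.exp c - 1) * prob (E r))
    linarith

/-- Chernoff's bound, upper tail. -/
theorem prob_two_mul_add_le_count [Nonempty α] [DecidableEq ι] (E : ι → α → Prop) (t : ℝ) :
    prob (fun ω : ι → α => 2 * ∑ r, prob (E r) + t ≤ count fun r => E r (ω r)) ≤
      Real.exp (-t) := by
  have h := sum_exp_count_le E 1
  have hs : 0 ≤ ∑ r, prob (E r) := Finset.sum_nonneg fun r _ => prob_nonneg _
  have he : Real.exp 1 - 1 ≤ 2 := by have := Real.exp_one_lt_d9; linarith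
  simp only [one_mul] at h
  refine (prob_le_of_exp_moment _ _ _ h).trans ?_
  rw [← Real.exp_add]
  apply Real.exp_le_exp.2
  nlinarith

/-- Chernoff's bound, lower tail. -/
theorem prob_count_le_quarter [Nonempty α] [DecidableEq ι] (E : ι → α → Prop) :
    prob (fun ω : ι → α => (count fun r => E r (ω r)) ≤ (∑ r, prob (E r)) / 4) ≤
      Real.exp (-((∑ r, prob (E r)) / 4)) := by
  have h := sum_exp_count_le E (-1)
  have hs : 0 ≤ ∑ r, prob (E r) := Finset.sum_nonneg fun r _ => prob_nonneg _
  have he : Real.exp (-1) - 1 ≤ -(1 / 2) := by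
    have := Real.exp_neg_one_lt_d9; linarith
  have h2 := prob_le_of_exp_moment _ (-((∑ r, prob (E r)) / 4)) _ h
  refine (prob_mono fun ω hω => ?_).trans (h2.trans ?_)
  · linarith
  · rw [← Real.exp_add]
    apply Real.exp_le_exp.2
    nlinarith

end Counting

/-! ### Random signs -/

/-- The sign `±1` encoded by a Boolean. -/
def sgn (b : Bool) : ℝ := if b then 1 else -1

theorem sgn_not (b : Bool) : sgn (!b) = -sgn b := by cases b <;> simp [sgn]

theorem sgn_eq (b : Bool) : sgn b = 1 ∨ sgn b = -1 := by cases b <;> simp [sgn]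

theorem abs_sgn (b : Bool) : |sgn b| = 1 := by cases b <;> simp [sgn]

theorem sgn_mul_self (b : Bool) : sgn b * sgn b = 1 := by cases b <;> simp [sgn]

section Signs

variable {ι : Type*} [DecidableEq ι]

/-- Reverse the signs with index in `U`. -/
def flip (U : Finset ι) : (ι → Bool) ≃ (ι → Bool) where
  toFun v i := if i ∈ U then !v i else v i
  invFun v i := if i ∈ U then !v i else v i
  left_inv v := by ext i; by_cases h : i ∈ U <;> simp [h]
  right_inv v := by ext i; by_cases h : i ∈ U <;> simp [h]

theorem flip_apply (U : Finset ι) (v : ι → Bool) (i : ι) :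
    flip U v i = if i ∈ U then !v i else v i := rfl

variable [Fintype ι]

theorem sum_exp_sum_sgn_le (a : ι → ℝ) (S : Finset ι) (l V : ℝ) (hV : ∑ j ∈ S, a j ^ 2 ≤ V) :
    ∑ v : ι → Bool, Real.exp (l * ∑ j ∈ S, a j * sgn (v j)) ≤
      Fintype.card (ι → Bool) * Real.exp (l ^ 2 * V / 2) := by
  have h1 : ∀ v : ι → Bool, Real.exp (l * ∑ j ∈ S, a j * sgn (v j))
      = ∏ j, Real.exp (if j ∈ S then l * (a j * sgn (v j)) else 0) := by
    intro v
    rw [← Real.exp_sum, Finset.mul_sum, Finset.sum_ite_mem, Finset.univ_inter]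
  have h3 := Finset.prod_univ_sum (fun _ : ι => (Finset.univ : Finset Bool))
    (fun j b => Real.exp (if j ∈ S then l * (a j * sgn b) else 0))
  rw [Fintype.piFinset_univ] at h3
  simp only [h1]
  rw [← h3]
  have h4 : ∀ j, ∑ b : Bool, Real.exp (if j ∈ S then l * (a j * sgn b) else 0)
      ≤ 2 * Real.exp (if j ∈ S then (l * a j) ^ 2 / 2 else 0) := by
    intro j
    split_ifs with hj
    · have := Real.cosh_le_exp_half_sq (l * a j)
      rw [Real.cosh_eq] at this
      simp only [Fintype.sum_bool, sgn, if_true, Bool.false_eq_true, if_false, mul_one, mul_neg]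
      linarith
    · simp
  refine (Finset.prod_le_prod (fun j _ => Finset.sum_nonneg fun b _ => Real.exp_nonneg _)
    (fun j _ => h4 j)).trans ?_
  rw [Finset.prod_mul_distrib, ← Real.exp_sum, Finset.sum_ite_mem, Finset.univ_inter]
  simp only [Finset.prod_const, Finset.card_univ, Fintype.card_fun, Fintype.card_bool, Nat.cast_pow,
    Nat.cast_ofNat]
  refine mul_le_mul_of_nonneg_left (Real.exp_le_exp.2 ?_) (by positivity)
  have : ∑ j ∈ S, (l * a j) ^ 2 / 2 = l ^ 2 * (∑ j ∈ S, a j ^ 2) / 2 := by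
    rw [Finset.mul_sum, Finset.sum_div]
    exact Finset.sum_congr rfl fun j _ => by ring
  rw [this]
  have := mul_le_mul_of_nonneg_left hV (sq_nonneg l)
  linarith

/-- Hoeffding's inequality for sums of independent random signs. -/
theorem prob_le_abs_sum_sgn (a : ι → ℝ) (S : Finset ι) {V t : ℝ} (hV0 : 0 < V)
    (hV : ∑ j ∈ S, a j ^ 2 ≤ V) (ht : 0 < t) :
    prob (fun v : ι → Bool => t ≤ |∑ j ∈ S, a j * sgn (v j)|) ≤
      2 * Real.exp (-(t ^ 2 / (2 * V))) := by
  have key : ∀ s : ℝ, s ^ 2 = 1 →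
      prob (fun v : ι → Bool => t ≤ s * ∑ j ∈ S, a j * sgn (v j)) ≤
        Real.exp (-(t ^ 2 / (2 * V))) := by
    intro s hs
    have h := sum_exp_sum_sgn_le a S (t / V * s) V hV
    refine (prob_mono fun v hv => ?_).trans
      ((prob_le_of_exp_moment _ (t / V * t) _ h).trans_eq ?_)
    · have : 0 < t / V := by positivity
      nlinarith
    · rw [← Real.exp_add, mul_pow, hs]
      congr 1
      field_simp
      ring
  have h1 := key 1 (by norm_num)
  have h2 := key (-1) (by norm_num)
  refine (prob_mono fun v hv => ?_).trans
    ((prob_or_le _ _).trans ((add_le_add h1 h2).trans_eq (by ring)))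
  rcases le_abs.1 hv with h | h
  · left; linarith
  · right; linarith

end Signs

/-! ### Signed sums that are almost always close to `0` or `±1` -/

/-- The real number `t` is within `1/10` of `0`, `1` or `-1`. -/
def Near (t : ℝ) : Prop := ∃ s : SignType, |t - (s : ℝ)| ≤ 1 / 10

open scoped Classical in
/-- Round a real number to `0`, `1` or `-1`. -/
noncomputable def rnd (t : ℝ) : SignType := if 1 / 2 < t then 1 else if t < -(1 / 2) then -1 else 0

theorem rnd_eq {t : ℝ} {s : SignType} (h : |t - (s : ℝ)| ≤ 1 / 10) : rnd t = s := by
  rw [abs_le] at h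
  unfold rnd
  cases s <;> simp at h
  · rw [if_neg (by linarith), if_neg (by linarith)]; rfl
  · rw [if_neg (by linarith), if_pos (by linarith)]; rfl
  · rw [if_pos (by linarith)]; rfl

theorem Near.abs_sub_rnd {t : ℝ} (h : Near t) : |t - (rnd t : ℝ)| ≤ 1 / 10 := by
  obtain ⟨s, hs⟩ := h
  rwa [rnd_eq hs]

theorem Near.abs_le {t : ℝ} (h : Near t) : |t| ≤ 11 / 10 := by
  obtain ⟨s, hs⟩ := h
  rw [_root_.abs_le] at hs ⊢
  cases s <;> simp at hs <;> constructor <;> linarith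

theorem rnd_eq_of_abs_sub_lt {t u : ℝ} (ht : Near t) (hu : Near u) (h : |t - u| < 4 / 5) :
    rnd t = rnd u := by
  obtain ⟨s, hs⟩ := ht
  obtain ⟨s', hs'⟩ := hu
  rw [rnd_eq hs, rnd_eq hs']
  rw [abs_le] at hs hs'
  rw [abs_lt] at h
  cases s <;> cases s' <;> simp at hs hs' ⊢ <;> linarith

section Chain

variable {ι : Type*} [DecidableEq ι]

/-- A chain of sets from `∅` to `S` that grows by one element at a time, in the form used here:
a quantity that does not change along the steps has the same value at `∅` and `S`. -/
theorem exists_chain (S : Finset ι) : ∃ C : Finset (Finset ι), C.card ≤ S.card + 1 ∧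
    ∅ ∈ C ∧ S ∈ C ∧ ∀ Q : Finset ι → SignType,
      (∀ j ∈ S, ∀ U ⊆ S, j ∉ U → U ∈ C → insert j U ∈ C → Q U = Q (insert j U)) → Q ∅ = Q S := by
  induction S using Finset.induction_on with
  | empty => exact ⟨{∅}, by simp, by simp, by simp, fun Q _ => rfl⟩
  | insert a S ha ih =>
    obtain ⟨C, h1, h2, h3, h4⟩ := ih
    refine ⟨insert (insert a S) C, ?_, by simp [h2], by simp, fun Q hQ => ?_⟩
    · refine (Finset.card_insert_le _ _).trans ?_
      rw [Finset.card_insert_of_notMem ha]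
      omega
    · rw [h4 Q fun j hj U hU hjU hUC hjUC => hQ j (by simp [hj]) U
        (hU.trans (Finset.subset_insert _ _)) hjU (by simp [hUC]) (by simp [hjUC])]
      exact hQ a (by simp) S (Finset.subset_insert _ _) ha (by simp [h3]) (by simp)

/-- A choice of the chain of sets in `exists_chain`. -/
noncomputable def chain (S : Finset ι) : Finset (Finset ι) := (exists_chain S).choose

theorem card_chain_le (S : Finset ι) : (chain S).card ≤ S.card + 1 :=
  (exists_chain S).choose_spec.1

theorem empty_mem_chain (S : Finset ι) : ∅ ∈ chain S := (exists_chain S).choose_spec.2.1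

theorem self_mem_chain (S : Finset ι) : S ∈ chain S := (exists_chain S).choose_spec.2.2.1

theorem eq_of_chain (S : Finset ι) (Q : Finset ι → SignType)
    (hQ : ∀ j ∈ S, ∀ U ⊆ S, j ∉ U → U ∈ chain S → insert j U ∈ chain S → Q U = Q (insert j U)) :
    Q ∅ = Q S :=
  (exists_chain S).choose_spec.2.2.2 Q hQ

/-- The signed sum `∑ j ∈ S, ± g j`. -/
def signedSum (g : ι → ℝ) (S : Finset ι) (v : ι → Bool) : ℝ := ∑ j ∈ S, g j * sgn (v j)

theorem signedSum_flip (g : ι → ℝ) {S U : Finset ι} (hU : U ⊆ S) (v : ι → Bool) :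
    signedSum g S (flip U v) = signedSum g S v - 2 * signedSum g U v := by
  have : signedSum g U v = ∑ j ∈ S, if j ∈ U then g j * sgn (v j) else 0 := by
    rw [Finset.sum_ite_mem, Finset.inter_eq_right.2 hU, signedSum]
  rw [this, signedSum, signedSum, Finset.mul_sum, ← Finset.sum_sub_distrib]
  refine Finset.sum_congr rfl fun j _ => ?_
  rw [flip_apply]
  split_ifs
  · rw [sgn_not]; ring
  · ring

theorem signedSum_insert (g : ι → ℝ) {U : Finset ι} {j : ι} (h : j ∉ U) (v : ι → Bool) :
    signedSum g (insert j U) v = g j * sgn (v j) + signedSum g U v :=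
  Finset.sum_insert h

/-- Along a chain of flips of small weights, the rounded signed sum is constant as long as all
the sums met are close to `0` or `±1`. -/
theorem rnd_signedSum_flip_eq {g : ι → ℝ} {S T : Finset ι} {v : ι → Bool} (hT : T ⊆ S)
    (hsmall : ∀ j ∈ T, |g j| < 2 / 5) (h : ∀ U ∈ chain T, Near (signedSum g S (flip U v))) :
    rnd (signedSum g S v) = rnd (signedSum g S (flip T v)) := by
  have := eq_of_chain T (fun U => rnd (signedSum g S (flip U v))) ?_
  · have h0 : flip ∅ v = v := by ext i; simp [flip_apply]
    simpa [h0] using this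
  · intro j hj U hU hjU hUC hjUC
    refine rnd_eq_of_abs_sub_lt (h _ hUC) (h _ hjUC) ?_
    rw [signedSum_flip g (hU.trans hT), signedSum_flip g (Finset.insert_subset (hT hj) (hU.trans hT)),
      signedSum_insert g hjU]
    have : |2 * (g j * sgn (v j))| < 4 / 5 := by
      rw [abs_mul, abs_mul, abs_sgn, abs_two]
      have := hsmall j hj
      linarith
    convert this using 2
    ring

/-- The signed sum at `v` is close to `0` or `±1`, and stays so when a single sign is reversed
and along a chain of reversals of all the signs in `S`. -/
def Robust (g : ι → ℝ) (S : Finset ι) (v : ι → Bool) : Prop :=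
  ∀ U ∈ chain S ∪ S.image fun j => {j}, Near (signedSum g S (flip U v))

theorem Robust.near {g : ι → ℝ} {S : Finset ι} {v : ι → Bool} (h : Robust g S v) :
    Near (signedSum g S v) := by
  have := h ∅ (by simp [empty_mem_chain])
  have h0 : flip ∅ v = v := by ext i; simp [flip_apply]
  rwa [h0] at this

theorem Robust.near_flip {g : ι → ℝ} {S : Finset ι} {v : ι → Bool} (h : Robust g S v) {j : ι}
    (hj : j ∈ S) : Near (signedSum g S v - 2 * (g j * sgn (v j))) := by
  have := h {j} (by simp [hj])
  rw [signedSum_flip g (by simpa using hj)] at this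
  simpa [signedSum] using this

/-- If all the weights are small, a robust signed sum rounds to `0`, since reversing all signs
one by one would lead from `1` to `-1` without a jump. -/
theorem Robust.rnd_eq_zero {g : ι → ℝ} {S : Finset ι} {v : ι → Bool} (h : Robust g S v)
    (hsmall : ∀ j ∈ S, |g j| < 2 / 5) : rnd (signedSum g S v) = 0 := by
  have h1 := rnd_signedSum_flip_eq subset_rfl hsmall (v := v)
    (fun U hU => h U (Finset.mem_union_left _ hU))
  rw [signedSum_flip g subset_rfl] at h1
  obtain ⟨s, hs⟩ := h.near
  have h2 : |signedSum g S v - 2 * signedSum g S v - ((-s : SignType) : ℝ)| ≤ 1 / 10 := by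
    rw [← abs_neg]; convert hs using 2; cases s <;> simp <;> ring
  rw [rnd_eq hs, rnd_eq h2] at h1
  rw [rnd_eq hs]
  revert h1; cases s <;> decide

/-- A robust signed sum that does not round to `0` has the sign of each of its large terms, since
reversing the sign of an opposite large term would push the sum beyond `11/10` in absolute value. -/
theorem Robust.rnd_eq_zero_or {g : ι → ℝ} {S : Finset ι} {v : ι → Bool} (h : Robust g S v) {j : ι}
    (hj : j ∈ S) (hbig : 2 / 5 ≤ |g j|) :
    rnd (signedSum g S v) = 0 ∨
      (rnd (signedSum g S v) : ℝ) = (SignType.sign (g j) : ℝ) * sgn (v j) := by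
  obtain ⟨s, hs⟩ := h.near
  have h2 := h.near_flip hj
  rw [rnd_eq hs]
  have h3 := h2.abs_le
  rw [abs_le] at hs h3
  have hg : g j = (SignType.sign (g j) : ℝ) * |g j| := (sign_mul_abs (g j)).symm
  rcases lt_trichotomy (g j) 0 with hneg | h0 | hpos
  · rw [abs_of_neg hneg] at hbig
    rw [sign_neg hneg]
    rcases sgn_eq (v j) with hv | hv <;> rw [hv] at h3 ⊢ <;> cases s <;> simp at hs h3 ⊢ <;> linarith
  · rw [h0] at hbig; norm_num at hbig
  · rw [abs_of_pos hpos] at hbig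
    rw [sign_pos hpos]
    rcases sgn_eq (v j) with hv | hv <;> rw [hv] at h3 ⊢ <;> cases s <;> simp at hs h3 ⊢ <;> linarith

theorem Robust.rnd_eq_of_large {g : ι → ℝ} {S : Finset ι} {v : ι → Bool} (h : Robust g S v) {j : ι}
    (hj : j ∈ S) (hbig : 7 / 10 < |g j|) :
    (rnd (signedSum g S v) : ℝ) = (SignType.sign (g j) : ℝ) * sgn (v j) := by
  rcases h.rnd_eq_zero_or hj (by linarith) with h0 | h1
  · exfalso
    have h2 := h.near.abs_sub_rnd
    have h3 := (h.near_flip hj).abs_le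
    rw [h0] at h2
    simp only [SignType.coe_zero, sub_zero] at h2
    have h4 : |2 * (g j * sgn (v j))| = 2 * |g j| := by
      rw [abs_mul, abs_mul, abs_sgn, abs_two, mul_one]
    have h5 := abs_sub (2 * (g j * sgn (v j)) - signedSum g S v) (-signedSum g S v)
    have h6 : |2 * (g j * sgn (v j)) - signedSum g S v - -signedSum g S v| = 2 * |g j| := by
      rw [← h4]; congr 1; ring
    rw [h6, abs_neg, abs_sub_comm] at h5
    linarith
  · exact h1

variable [Fintype ι]

theorem prob_not_near_flip (g : ι → ℝ) (S U : Finset ι) :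
    prob (fun v => ¬ Near (signedSum g S (flip U v))) = prob fun v => ¬ Near (signedSum g S v) :=
  prob_comp_equiv (flip U) fun v => ¬ Near (signedSum g S v)

theorem prob_not_near_flip_le (g : ι → ℝ) (S : Finset ι) (C : Finset (Finset ι)) :
    prob (fun v => ¬ ∀ U ∈ C, Near (signedSum g S (flip U v))) ≤
      C.card * prob fun v => ¬ Near (signedSum g S v) := by
  have := prob_exists_le_card_mul (fun (U : C) v => ¬ Near (signedSum g S (flip U.1 v)))
    (fun U => (prob_not_near_flip g S U).le)
  rw [Fintype.card_coe] at this
  refine (prob_mono fun v hv => ?_).trans this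
  simpa using hv

theorem prob_not_robust_le (g : ι → ℝ) (S : Finset ι) :
    prob (fun v => ¬ Robust g S v) ≤
      (2 * S.card + 1 : ℕ) * prob fun v => ¬ Near (signedSum g S v) := by
  refine (prob_not_near_flip_le g S _).trans
    (mul_le_mul_of_nonneg_right (Nat.cast_le.2 ?_) (prob_nonneg _))
  refine (Finset.card_union_le _ _).trans ?_
  have h1 := card_chain_le S
  have h2 : (S.image fun j => ({j} : Finset ι)).card ≤ S.card := Finset.card_image_le
  omega

theorem exists_near_flip {g : ι → ℝ} {S : Finset ι} (C : Finset (Finset ι))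
    (h : C.card * prob (fun v => ¬ Near (signedSum g S v)) < 1) :
    ∃ v, ∀ U ∈ C, Near (signedSum g S (flip U v)) :=
  exists_of_prob_not_lt_one ((prob_not_near_flip_le g S C).trans_lt h)

/-- Up to three weights have total size at most `11/10`: some choice of their signs, and the
opposite choice, make the signed sum close to `0` or `±1`. -/
theorem sum_abs_le_of_prob {g : ι → ℝ} {S T : Finset ι} (hT : T ⊆ S) (hT3 : T.card ≤ 3)
    (h : 8 * prob (fun v => ¬ Near (signedSum g S v)) < 1) : ∑ j ∈ T, |g j| ≤ 11 / 10 := by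
  obtain ⟨v, hv⟩ := exists_near_flip (g := g) (S := S) T.powerset <| by
    refine (mul_le_mul_of_nonneg_right ?_ (prob_nonneg _)).trans_lt h
    rw [Finset.card_powerset]
    exact_mod_cast Nat.pow_le_pow_right (by norm_num : 0 < 2) hT3
  -- the sets of signs to reverse so that all terms are nonnegative, or all are nonpositive
  have h1 := hv (T.filter fun j => g j * sgn (v j) < 0) (by simp)
  have h2 := hv (T.filter fun j => ¬ g j * sgn (v j) < 0) (by simp)
  rw [signedSum_flip g ((Finset.filter_subset _ _).trans hT)] at h1 h2
  have h3 : ∑ j ∈ T, |g j| = signedSum g (T.filter fun j => ¬ g j * sgn (v j) < 0) v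
      - signedSum g (T.filter fun j => g j * sgn (v j) < 0) v := by
    rw [← Finset.sum_filter_add_sum_filter_not T fun j => g j * sgn (v j) < 0, signedSum, signedSum,
      sub_eq_neg_add, ← Finset.sum_neg_distrib]
    have e : ∀ j, |g j| = |g j * sgn (v j)| := fun j => by rw [abs_mul, abs_sgn, mul_one]
    congr 1 <;> refine Finset.sum_congr rfl fun j hj => ?_ <;> rw [e]
    · exact abs_of_neg (Finset.mem_filter.1 hj).2
    · exact abs_of_nonneg (not_lt.1 (Finset.mem_filter.1 hj).2)
  have h4 := h1.abs_le
  have h5 := h2.abs_le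
  rw [abs_le] at h4 h5
  linarith [h4.2, h5.1]

/-- If only one weight is not small, then it is close to `±1`. -/
theorem lt_abs_of_prob {g : ι → ℝ} {S : Finset ι} {j : ι} (hj : j ∈ S)
    (hsmall : ∀ i ∈ S, i ≠ j → |g i| < 2 / 5) (hbig : 2 / 5 ≤ |g j|)
    (h : (S.card + 1) * prob (fun v => ¬ Near (signedSum g S v)) < 1) : 7 / 10 < |g j| := by
  obtain ⟨v, hv⟩ := exists_near_flip (g := g) (S := S) (chain (S.erase j)) <| by
    refine (mul_le_mul_of_nonneg_right ?_ (prob_nonneg _)).trans_lt h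
    have h1 := card_chain_le (S.erase j)
    have h2 := Finset.card_erase_le (s := S) (a := j)
    exact_mod_cast h1.trans (by omega)
  have h1 := rnd_signedSum_flip_eq (Finset.erase_subset j S)
    (fun i hi => hsmall i (Finset.mem_of_mem_erase hi) (Finset.ne_of_mem_erase hi)) hv
  have h0 : flip ∅ v = v := by ext i; simp [flip_apply]
  have h2 := (hv ∅ (empty_mem_chain _)).abs_sub_rnd
  have h3 := (hv _ (self_mem_chain _)).abs_sub_rnd
  rw [← h1] at h3
  rw [h0] at h2
  rw [signedSum_flip g (Finset.erase_subset j S)] at h3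
  have h4 : signedSum g S v = g j * sgn (v j) + signedSum g (S.erase j) v := by
    rw [← signedSum_insert g (Finset.notMem_erase j S), Finset.insert_erase hj]
  rw [h4] at h2 h3
  -- the average of the two sums is the single term `± g j`
  have h5 : |g j * sgn (v j) - (rnd (g j * sgn (v j) + signedSum g (S.erase j) v) : ℝ)| ≤ 1 / 10 := by
    rw [abs_le] at h2 h3 ⊢
    constructor <;> linarith [h2.1, h2.2, h3.1, h3.2]
  generalize rnd (g j * sgn (v j) + signedSum g (S.erase j) v) = s at h5
  have h6 : |g j| = |g j * sgn (v j)| := by rw [abs_mul, abs_sgn, mul_one]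
  rw [h6] at hbig ⊢
  rw [abs_le] at h5
  rcases le_abs.1 hbig with h7 | h7
  · refine lt_abs.2 (Or.inl ?_)
    cases s <;> simp at h5 <;> linarith
  · refine lt_abs.2 (Or.inr ?_)
    cases s <;> simp at h5 <;> linarith

end Chain

/-! ### Restricted isometry and nearly orthonormal columns -/

section RIP

variable {n m k : ℕ} {A : Matrix (Fin n) (Fin m) ℝ} {δ : ℝ}

theorem IsRIP.mono (h : IsRIP A k δ) {δ' : ℝ} (hδ : δ ≤ δ') : IsRIP A k δ' := by
  intro x hx
  obtain ⟨h1, h2⟩ := h x hx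
  have := norm_nonneg (WithLp.toLp 2 x)
  constructor <;> nlinarith

theorem IsRIP.sum_sq_le (h : IsRIP A k δ) (hδ1 : δ ≤ 1) (x : Fin m → ℝ)
    {T : Finset (Fin m)} (hT : T.card ≤ k) (hx : ∀ j ∉ T, x j = 0) :
    (1 - δ) ^ 2 * ∑ j, x j ^ 2 ≤ ∑ a, (A *ᵥ x) a ^ 2 ∧
      ∑ a, (A *ᵥ x) a ^ 2 ≤ (1 + δ) ^ 2 * ∑ j, x j ^ 2 := by
  have hs : (Function.support x).ncard ≤ k := by
    refine le_trans ?_ hT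
    rw [← Set.ncard_coe_finset]
    refine Set.ncard_le_ncard (fun j hj => ?_) T.finite_toSet
    by_contra hjT
    exact hj (hx j (by simpa using hjT))
  obtain ⟨h1, h2⟩ := h x hs
  have e1 : ∑ j, x j ^ 2 = ‖WithLp.toLp 2 x‖ ^ 2 := by
    rw [EuclideanSpace.real_norm_sq_eq]
  have e2 : ∑ a, (A *ᵥ x) a ^ 2 = ‖WithLp.toLp 2 (A *ᵥ x)‖ ^ 2 := by
    rw [EuclideanSpace.real_norm_sq_eq]
  rw [e1, e2, ← mul_pow, ← mul_pow]
  exact ⟨pow_le_pow_left₀ (mul_nonneg (by linarith) (norm_nonneg _)) h1 2,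
    pow_le_pow_left₀ (norm_nonneg _) h2 2⟩

theorem IsRIP.abs_apply_le (h : IsRIP A k δ) (hδ : 0 ≤ δ) (hδ1 : δ ≤ 1) (hk : 1 ≤ k)
    (a : Fin n) (i : Fin m) : |A a i| ≤ 2 := by
  have h1 := (h.sum_sq_le hδ1 (Pi.single i 1) (T := {i}) (by simpa using hk)
    (fun j hj => by simp at hj; simp [hj])).2
  have h2 : ∑ j, (Pi.single i (1 : ℝ) : Fin m → ℝ) j ^ 2 = 1 := by
    rw [Finset.sum_eq_single i] <;> simp +contextual
  rw [h2] at h1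
  simp only [Matrix.mulVec_single_one, Matrix.col_apply] at h1
  have h3 := Finset.single_le_sum (f := fun a => A a i ^ 2) (fun a _ => sq_nonneg _)
    (Finset.mem_univ a)
  apply abs_le_of_sq_le_sq _ (by norm_num)
  nlinarith

/-- Inner products of the columns of `A` with column `i`, compared with the identity matrix. -/
theorem IsRIP.sum_gram_sub_le (h : IsRIP A k δ) (hδ : 0 ≤ δ) (hδ1 : δ ≤ 1) (i : Fin m)
    {T : Finset (Fin m)} (hT : (insert i T).card ≤ k) :
    ∑ j ∈ T, ((∑ a, A a j * A a i) - if j = i then 1 else 0) ^ 2 ≤ 9 * δ ^ 2 := by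
  set d : Fin m → ℝ := fun j => (∑ a, A a j * A a i) - if j = i then 1 else 0 with hd
  set D := ∑ j ∈ T, d j ^ 2 with hD
  have hD0 : 0 ≤ D := Finset.sum_nonneg fun j _ => sq_nonneg _
  rcases hD0.eq_or_lt with h0 | hpos
  · rw [← h0]; positivity
  set r := Real.sqrt D with hr
  have hrpos : 0 < r := Real.sqrt_pos.2 hpos
  have hr2 : r ^ 2 = D := Real.sq_sqrt hD0
  set e : ℝ := if i ∈ T then d i else 0 with he
  have her : |e| ≤ r := by
    refine abs_le_of_sq_le_sq ?_ hrpos.le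
    rw [hr2, he]
    split_ifs with hi
    · exact Finset.single_le_sum (f := fun j => d j ^ 2) (fun j _ => sq_nonneg _) hi
    · simpa using hD0
  -- test the restricted isometry on `u ± w` with `u` a basis vector and `w` parallel to `d`
  set t := r⁻¹ with ht
  set u : Fin m → ℝ := Pi.single i 1 with hu
  set w : Fin m → ℝ := fun j => if j ∈ T then t * d j else 0 with hw
  have hout : ∀ j ∉ insert i T, u j = 0 ∧ w j = 0 := by
    intro j hj
    simp only [Finset.mem_insert, not_or] at hj
    exact ⟨by simp [hu, hj.1], by simp [hw, hj.2]⟩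
  have hp := (h.sum_sq_le hδ1 (u + w) hT fun j hj => by simp [hout j hj]).2
  have hm := (h.sum_sq_le hδ1 (u - w) hT fun j hj => by simp [hout j hj]).1
  have huu : ∑ j, u j ^ 2 = 1 := by
    rw [Finset.sum_eq_single i] <;> simp +contextual [hu]
  have hww : ∑ j, w j ^ 2 = t ^ 2 * D := by
    rw [hD, Finset.mul_sum, ← Finset.univ_inter T, ← Finset.sum_ite_mem]
    refine Finset.sum_congr rfl fun j _ => ?_
    simp only [hw]; split_ifs <;> ring
  have huw : ∑ j, u j * w j = t * e := by
    rw [Finset.sum_eq_single i]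
    · simp only [hu, hw, he, Pi.single_eq_same]; split_ifs <;> simp
    · intro j _ hj; simp [hu, hj]
    · simp
  have hAuw : ∑ a, (A *ᵥ u) a * (A *ᵥ w) a = t * (D + e) := by
    have h1 : ∑ a, (A *ᵥ u) a * (A *ᵥ w) a = ∑ j, w j * ∑ a, A a j * A a i := by
      have hu1 : ∀ a, (A *ᵥ u) a = A a i := fun a => by simp [hu]
      simp only [hu1]
      simp only [Matrix.mulVec, dotProduct, Finset.mul_sum]
      rw [Finset.sum_comm]
      exact Finset.sum_congr rfl fun j _ => Finset.sum_congr rfl fun a _ => by ring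
    have h2 : ∀ j, ∑ a, A a j * A a i = d j + if j = i then 1 else 0 := fun j => by simp [hd]
    rw [h1, mul_add, ← huw, hD, Finset.mul_sum, ← Finset.univ_inter T, ← Finset.sum_ite_mem,
      ← Finset.sum_add_distrib]
    refine Finset.sum_congr rfl fun j _ => ?_
    rw [h2]
    by_cases hji : j = i
    · subst hji; simp only [hw, hu, if_true, Pi.single_eq_same]; split_ifs <;> ring
    · simp only [hw, hu, hji, if_false, Pi.single_eq_of_ne hji]
      split_ifs <;> ring
  have e1 : ∑ j, (u + w) j ^ 2 = 1 + 2 * (t * e) + t ^ 2 * D := by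
    rw [← huu, ← hww, ← huw, Finset.mul_sum, ← Finset.sum_add_distrib, ← Finset.sum_add_distrib]
    exact Finset.sum_congr rfl fun j _ => by simp only [Pi.add_apply]; ring
  have e2 : ∑ j, (u - w) j ^ 2 = 1 - 2 * (t * e) + t ^ 2 * D := by
    rw [← huu, ← hww, ← huw, Finset.mul_sum, ← Finset.sum_sub_distrib, ← Finset.sum_add_distrib]
    exact Finset.sum_congr rfl fun j _ => by simp only [Pi.sub_apply]; ring
  have e3 : ∑ a, (A *ᵥ (u + w)) a ^ 2 - ∑ a, (A *ᵥ (u - w)) a ^ 2 = 4 * (t * (D + e)) := by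
    rw [← hAuw, Finset.mul_sum, ← Finset.sum_sub_distrib, Matrix.mulVec_add, Matrix.mulVec_sub]
    exact Finset.sum_congr rfl fun j _ => by simp only [Pi.sub_apply, Pi.add_apply]; ring
  rw [e1] at hp
  rw [e2] at hm
  have htD : t ^ 2 * D = 1 := by rw [← hr2, ht]; field_simp
  have htD' : t * D = r := by rw [← hr2, ht]; field_simp
  have hte : t * e ≤ 1 := by
    rw [ht, inv_mul_le_iff₀ hrpos, mul_one]; exact (abs_le.1 her).2
  rw [htD] at hp hm
  have h3 : r ≤ 3 * δ := by
    have : 4 * (r + t * e) ≤ 4 * δ * 2 + 4 * (1 + δ ^ 2) * (t * e) := by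
      rw [mul_add, htD'] at e3; nlinarith
    nlinarith [mul_nonneg (sq_nonneg δ) (sub_nonneg.2 hte), mul_nonneg hδ (sub_nonneg.2 hδ1)]
  rw [← hr2]
  nlinarith

theorem IsRIP.sum_gram_sub_le' (h : IsRIP A k δ) (hδ : 0 ≤ δ) (hδ1 : δ ≤ 1) (hk : 2 ≤ k)
    (i : Fin m) {S : Finset (Fin m)} (hS : S.card ≤ k) :
    ∑ j ∈ S, ((∑ a, A a j * A a i) - if j = i then 1 else 0) ^ 2 ≤ 18 * δ ^ 2 := by
  rcases S.eq_empty_or_nonempty with rfl | ⟨j₀, hj₀⟩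
  · simp; positivity
  · have h1 := h.sum_gram_sub_le hδ hδ1 i (T := {j₀}) ((Finset.card_insert_le _ _).trans (by simpa))
    have h2 := h.sum_gram_sub_le hδ hδ1 i (T := S.erase j₀) <| by
      refine (Finset.card_insert_le _ _).trans ?_
      rw [Finset.card_erase_add_one hj₀]
      exact hS
    rw [← Finset.add_sum_erase S _ hj₀]
    rw [Finset.sum_singleton] at h1
    linarith

/-- The coefficient vector with support `S` and signs `v`. -/
def coeff (S : Finset (Fin m)) (v : Fin m → Bool) (i : Fin m) : ℝ := if i ∈ S then sgn (v i) else 0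

/-- A vector close to column `i` recovers the `i`-th coefficient by taking inner products. -/
theorem prob_decode_le (h : IsRIP A k δ) (hδ : 0 < δ) (hδ1 : δ ≤ 1) (hk : 2 ≤ k)
    (i : Fin m) {S : Finset (Fin m)} (hS : S.card ≤ k) {z : Fin n → ℝ} {ε : ℝ}
    (hz : ∀ a, |z a - A a i| ≤ ε) (hε : 100 * (n * k * ε) ≤ 1) :
    prob (fun v => ¬ |signedSum (fun j => ∑ a, A a j * z a) S v - coeff S v i| ≤ 1 / 10) ≤
      2 * Real.exp (-(1 / (5625 * δ ^ 2))) := by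
  have hV := h.sum_gram_sub_le' hδ.le hδ1 hk i hS
  have hH := prob_le_abs_sum_sgn _ S (by positivity) hV (by norm_num : (0 : ℝ) < 8 / 100)
  have e : (8 / 100 : ℝ) ^ 2 / (2 * (18 * δ ^ 2)) = 1 / (5625 * δ ^ 2) := by field_simp; norm_num
  rw [e] at hH
  refine (prob_mono fun v hv => ?_).trans hH
  rw [not_le] at hv
  have h1 : signedSum (fun j => ∑ a, A a j * z a) S v - coeff S v i
      = (∑ j ∈ S, ((∑ a, A a j * A a i) - if j = i then 1 else 0) * sgn (v j))
        + ∑ j ∈ S, (∑ a, A a j * (z a - A a i)) * sgn (v j) := by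
    have : coeff S v i = ∑ j ∈ S, (if j = i then (1 : ℝ) else 0) * sgn (v j) := by
      simp [coeff]
    rw [this, signedSum, ← Finset.sum_sub_distrib, ← Finset.sum_add_distrib]
    refine Finset.sum_congr rfl fun j _ => ?_
    have : ∑ a, A a j * (z a - A a i) = ∑ a, A a j * z a - ∑ a, A a j * A a i := by
      rw [← Finset.sum_sub_distrib]
      exact Finset.sum_congr rfl fun a _ => by ring
    rw [this]; ring
  have h2 : |∑ j ∈ S, (∑ a, A a j * (z a - A a i)) * sgn (v j)| ≤ 2 / 100 := by
    have hterm : ∀ j ∈ S, |(∑ a, A a j * (z a - A a i)) * sgn (v j)| ≤ n * (2 * ε) := by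
      intro j _
      rw [abs_mul, abs_sgn, mul_one]
      refine (Finset.abs_sum_le_sum_abs _ _).trans ((Finset.sum_le_sum fun a _ =>
        (?_ : _ ≤ 2 * ε)).trans_eq (by simp))
      rw [abs_mul]
      exact mul_le_mul (h.abs_apply_le hδ.le hδ1 (by omega) a j) (hz a) (abs_nonneg _) (by norm_num)
    refine (Finset.abs_sum_le_sum_abs _ _).trans ((Finset.sum_le_sum hterm).trans ?_)
    rw [Finset.sum_const, nsmul_eq_mul]
    rcases S.eq_empty_or_nonempty with rfl | ⟨j₀, hj₀⟩
    · simp; norm_num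
    · have h0 := (abs_nonneg _).trans (hterm j₀ hj₀)
      have : (S.card : ℝ) ≤ k := by exact_mod_cast hS
      nlinarith
  rw [h1] at hv
  have h3 := abs_add_le (∑ j ∈ S, ((∑ a, A a j * A a i) - if j = i then 1 else 0) * sgn (v j))
    (∑ j ∈ S, (∑ a, A a j * (z a - A a i)) * sgn (v j))
  linarith

end RIP

/-! ### Algebraic decision trees -/

section Trees

variable {ι κ : Type}

/-- The property `V` of the input can be tested by an algebraic decision tree: any two trees can
be joined into one which behaves like the first where `V` holds and like the second elsewhere. -/
def Testable (κ : Type) (V : (ι → ℝ) → Prop) : Prop :=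
  ∀ T₁ T₂ : Algorithm ι κ, ∃ T : Algorithm ι κ, ∀ y,
    (V y → T.run y = T₁.run y) ∧ (¬ V y → T.run y = T₂.run y)

theorem testable_nonneg (p : MvPolynomial ι ℝ) :
    Testable κ fun y => 0 ≤ MvPolynomial.eval y p := fun T₁ T₂ =>
  ⟨.branch p T₁ T₂, fun y => ⟨fun h => by simp [Algorithm.run, h],
    fun h => by simp only [Algorithm.run, if_neg h]⟩⟩

theorem Testable.and {V W : (ι → ℝ) → Prop} (hV : Testable κ V) (hW : Testable κ W) :
    Testable κ fun y => V y ∧ W y := by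
  intro T₁ T₂
  obtain ⟨T, hT⟩ := hW T₁ T₂
  obtain ⟨T', hT'⟩ := hV T T₂
  refine ⟨T', fun y => ⟨fun h => ?_, fun h => ?_⟩⟩
  · rw [(hT' y).1 h.1, (hT y).1 h.2]
  · by_cases hv : V y
    · rw [(hT' y).1 hv, (hT y).2 fun hw => h ⟨hv, hw⟩]
    · rw [(hT' y).2 hv]

theorem testable_const (P : Prop) : Testable κ fun _ : ι → ℝ => P := by
  intro T₁ T₂
  by_cases h : P
  · exact ⟨T₁, fun y => ⟨fun _ => rfl, fun h' => absurd h h'⟩⟩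
  · exact ⟨T₂, fun y => ⟨fun h' => absurd h' h, fun _ => rfl⟩⟩

theorem Testable.congr {V W : (ι → ℝ) → Prop} (hV : Testable κ V) (h : ∀ y, V y ↔ W y) :
    Testable κ W := by
  have : V = W := funext fun y => propext (h y)
  rwa [← this]

theorem testable_forall {α : Type*} [Finite α] {V : α → (ι → ℝ) → Prop}
    (hV : ∀ a, Testable κ (V a)) : Testable κ fun y => ∀ a, V a y := by
  classical
  have := Fintype.ofFinite α
  suffices h : ∀ s : Finset α, Testable κ fun y => ∀ a ∈ s, V a y from
    (h Finset.univ).congr fun y => by simp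
  intro s
  induction s using Finset.induction_on with
  | empty => exact (testable_const True).congr fun y => by simp
  | insert a s _ ih => exact ((hV a).and ih).congr fun y => by simp

theorem testable_abs_le (p : MvPolynomial ι ℝ) (c : ℝ) :
    Testable κ fun y => |MvPolynomial.eval y p| ≤ c := by
  refine ((testable_nonneg (MvPolynomial.C c - p)).and
    (testable_nonneg (MvPolynomial.C c + p))).congr fun y => ?_
  simp only [map_sub, map_add, MvPolynomial.eval_C, abs_le]
  constructor
  · rintro ⟨h1, h2⟩; constructor <;> linarith
  · rintro ⟨h1, h2⟩; constructor <;> linarith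

theorem testable_imp {V : (ι → ℝ) → Prop} (P : Prop) (hV : Testable κ V) :
    Testable κ fun y => P → V y := by
  by_cases h : P
  · exact hV.congr fun y => by simp [h]
  · exact (testable_const True).congr fun y => by simp [h]

/-- Exhaustive search: a decision tree can try a finite list of candidates with testable validity,
and return the output that belongs to some valid candidate. -/
theorem exists_search {α : Type*} [Finite α] {V : α → (ι → ℝ) → Prop}
    (hV : ∀ a, Testable κ (V a)) (out : α → κ → MvPolynomial ι ℝ) :
    ∃ T : Algorithm ι κ, ∀ y, (∃ a, V a y) →
      ∃ a, V a y ∧ T.run y = fun j => MvPolynomial.eval y (out a j) := by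
  classical
  have := Fintype.ofFinite α
  suffices h : ∀ s : Finset α, ∃ T : Algorithm ι κ, ∀ y, (∃ a ∈ s, V a y) →
      ∃ a, V a y ∧ T.run y = fun j => MvPolynomial.eval y (out a j) by
    obtain ⟨T, hT⟩ := h Finset.univ
    exact ⟨T, fun y ⟨a, ha⟩ => hT y ⟨a, Finset.mem_univ a, ha⟩⟩
  intro s
  induction s using Finset.induction_on with
  | empty => exact ⟨.output fun _ => 0, fun y ⟨a, ha, _⟩ => absurd ha (Finset.notMem_empty a)⟩
  | insert a s _ ih =>
    obtain ⟨T, hT⟩ := ih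
    obtain ⟨T', hT'⟩ := hV a (.output (out a)) T
    refine ⟨T', fun y ⟨b, hb, hby⟩ => ?_⟩
    by_cases hay : V a y
    · exact ⟨a, hay, (hT' y).1 hay⟩
    · rw [(hT' y).2 hay]
      refine hT y ⟨b, ?_, hby⟩
      rcases Finset.mem_insert.1 hb with rfl | hb
      · exact absurd hby hay
      · exact hb

end Trees

/-! ### Linear relations between integer vectors and reduction modulo `3` -/

/-- A nonzero real vector `u` can be replaced by an integer vector which is nonzero modulo `3` and
satisfies all linear relations over `ℤ` that `u` satisfies: take a coordinate in a `ℤ`-basis of the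
free abelian group generated by the entries of `u`. -/
theorem exists_int_ne_zero_mod_three {ι : Type*} [Fintype ι] {u : ι → ℝ} (hu : u ≠ 0) :
    ∃ w : ι → ℤ, (∃ i, (w i : ZMod 3) ≠ 0) ∧
      ∀ x : ι → ℤ, ∑ i, u i * x i = 0 → ∑ i, w i * x i = 0 := by
  set M : Submodule ℤ ℝ := Submodule.span ℤ (Set.range u) with hM
  have hmem : ∀ i, u i ∈ M := fun i => Submodule.subset_span ⟨i, rfl⟩
  have : Module.Finite ℤ M := Module.Finite.span_of_finite ℤ (Set.finite_range u)
  have : Module.Free ℤ M := inferInstance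
  obtain ⟨i₀, hi₀⟩ := Function.ne_iff.1 hu
  have hnt : Nontrivial M :=
    ⟨⟨⟨u i₀, hmem i₀⟩, 0, fun h => hi₀ (by simpa using congrArg Subtype.val h)⟩⟩
  let b := Module.Free.chooseBasis ℤ M
  obtain ⟨c⟩ : Nonempty (Module.Free.ChooseBasisIndex ℤ M) := b.index_nonempty
  let φ : M →ₗ[ℤ] ℤ := b.coord c
  refine ⟨fun i => φ ⟨u i, hmem i⟩, ?_, fun x hx => ?_⟩
  · by_contra! hall
    have hdiv : ∀ (y : ℝ) (hy : y ∈ M), (3 : ℤ) ∣ φ ⟨y, hy⟩ := by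
      intro y hy
      induction hy using Submodule.span_induction with
      | mem y h =>
        obtain ⟨i, rfl⟩ := h
        exact (ZMod.intCast_zmod_eq_zero_iff_dvd _ 3).1 (hall i)
      | zero => exact (map_zero φ) ▸ dvd_zero 3
      | add y z hy hz h1 h2 =>
        have : φ ⟨y + z, M.add_mem hy hz⟩ = φ ⟨y, hy⟩ + φ ⟨z, hz⟩ := map_add φ ⟨y, hy⟩ ⟨z, hz⟩
        rw [this]; exact dvd_add h1 h2
      | smul a y hy h =>
        have : φ ⟨a • y, M.smul_mem a hy⟩ = a • φ ⟨y, hy⟩ := map_smul φ a ⟨y, hy⟩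
        rw [this]; exact Dvd.dvd.mul_left h a
    have h1 : φ (b c) = 1 := by simp [φ]
    have h2 := hdiv (b c).1 (b c).2
    rw [Subtype.coe_eta, h1] at h2
    norm_num at h2
  · have h1 : ∑ i, x i • (⟨u i, hmem i⟩ : M) = 0 := by
      apply Subtype.ext
      simp only [AddSubmonoidClass.coe_finsetSum, SetLike.val_smul, zsmul_eq_mul,
        ZeroMemClass.coe_zero]
      rw [← hx]
      exact Finset.sum_congr rfl fun i _ => mul_comm _ _
    have h2 := congrArg φ h1
    rw [map_sum, map_zero] at h2
    rw [← h2]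
    refine Finset.sum_congr rfl fun i _ => ?_
    rw [map_smul, smul_eq_mul, mul_comm]

section Coefficients

variable {m N : ℕ}

/-- The coefficient vector with support `S` and signs `v`, modulo `3`. -/
def coeffMod (S : Finset (Fin m)) (v : Fin m → Bool) (i : Fin m) : ZMod 3 :=
  if i ∈ S then (if v i then 1 else -1) else 0

/-- If every nonzero vector modulo `3` is detected by at least `c` samples, the same holds for every
nonzero real vector. -/
theorem count_dot_ne_zero_of_mod_three {S : Fin N → Finset (Fin m)} {v : Fin N → Fin m → Bool}
    {c : ℝ} (h : ∀ u : Fin m → ZMod 3, u ≠ 0 →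
      c ≤ count fun r => ∑ i, u i * coeffMod (S r) (v r) i ≠ 0)
    {u : Fin m → ℝ} (hu : u ≠ 0) : c ≤ count fun r => ∑ i, u i * coeff (S r) (v r) i ≠ 0 := by
  obtain ⟨w, ⟨i, hi⟩, hw⟩ := exists_int_ne_zero_mod_three hu
  refine (h (fun i => (w i : ZMod 3)) fun h0 => hi (congrFun h0 i)).trans (count_mono ?_)
  intro r hr h0
  apply hr
  have h1 := hw (fun i => if i ∈ S r then (if v r i then 1 else -1) else 0) <| by
    rw [← h0]
    refine Finset.sum_congr rfl fun j _ => ?_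
    unfold coeff sgn
    split_ifs <;> simp
  have h2 := congrArg (Int.cast : ℤ → ZMod 3) h1
  rw [Int.cast_sum, Int.cast_zero] at h2
  rw [← h2]
  refine Finset.sum_congr rfl fun j _ => ?_
  unfold coeffMod
  split_ifs <;> simp

theorem half_le_prob_dot_coeffMod_ne_zero {S : Finset (Fin m)} {u : Fin m → ZMod 3} {i : Fin m}
    (hi : i ∈ S) (hu : u i ≠ 0) :
    1 / 2 ≤ prob fun v => ∑ j, u j * coeffMod S v j ≠ 0 := by
  refine half_le_prob_of_equiv (flip {i}) fun v hv => ?_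
  rw [not_not] at hv
  have h1 : ∑ j, u j * coeffMod S (flip {i} v) j - ∑ j, u j * coeffMod S v j
      = u i * coeffMod S v i := by
    rw [← Finset.sum_sub_distrib, Finset.sum_eq_single i]
    · simp only [coeffMod, flip_apply, hi, if_true, Finset.mem_singleton]
      have h3 : (-1 - 1 : ZMod 3) = 1 ∧ (1 - -1 : ZMod 3) = -1 := by decide
      cases v i <;> simp only [Bool.not_true, Bool.not_false, if_true, if_false, ← mul_sub,
        Bool.false_eq_true, h3.1, h3.2]
    · intro j _ hj
      simp [coeffMod, flip_apply, hj]
    · simp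
  rw [hv, sub_zero] at h1
  rw [h1]
  simp only [coeffMod, hi, if_true]
  split_ifs <;> simpa using hu

theorem half_le_prob_sgn_mul {i j : Fin m} (hij : i ≠ j) {s : ℝ} (hs : s = 1 ∨ s = -1) :
    1 / 2 ≤ prob fun v : Fin m → Bool => sgn (v i) * sgn (v j) = s := by
  refine half_le_prob_of_equiv (flip {i}) fun v hv => ?_
  simp only [flip_apply, Finset.mem_singleton, if_true, hij.symm, if_false, sgn_not]
  rcases hs with rfl | rfl <;> rcases sgn_eq (v i) with h1 | h1 <;>
    rcases sgn_eq (v j) with h2 | h2 <;> simp_all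

/-! ### Signals decoded from the samples -/

/-- The probability, over the signs of a sample with support `S`, that the decoder with weights `g`
fails to give a value close to `0` or `±1`. -/
noncomputable def failure (g : Fin m → ℝ) (S : Finset (Fin m)) : ℝ :=
  prob fun v => ¬ Near (signedSum g S v)

/-- For the support `S` the decoder `g` fails so rarely that short lists of sign patterns without
failure exist. -/
def Regular (k : ℕ) (g : Fin m → ℝ) (S : Finset (Fin m)) : Prop :=
  8 * (k + 1) * failure g S < 1

theorem Regular.sum_abs_le {k : ℕ} {g : Fin m → ℝ} {S T : Finset (Fin m)} (h : Regular k g S)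
    (hT : T ⊆ S) (hT3 : T.card ≤ 3) : ∑ j ∈ T, |g j| ≤ 11 / 10 := by
  refine sum_abs_le_of_prob hT hT3 (lt_of_le_of_lt ?_ h)
  have := prob_nonneg fun v => ¬ Near (signedSum g S v)
  unfold failure
  have hk : (0 : ℝ) ≤ k := Nat.cast_nonneg k
  nlinarith

theorem Regular.lt_abs {k : ℕ} {g : Fin m → ℝ} {S : Finset (Fin m)} (h : Regular k g S)
    (hS : S.card ≤ k) {j : Fin m} (hj : j ∈ S) (hsmall : ∀ i ∈ S, i ≠ j → |g i| < 2 / 5)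
    (hbig : 2 / 5 ≤ |g j|) : 7 / 10 < |g j| := by
  refine lt_abs_of_prob hj hsmall hbig (lt_of_le_of_lt ?_ h)
  have := prob_nonneg fun v => ¬ Near (signedSum g S v)
  have hk : (S.card : ℝ) ≤ k := by exact_mod_cast hS
  unfold failure
  have hk : (0 : ℝ) ≤ k := Nat.cast_nonneg k
  nlinarith

variable {k : ℕ} {S : Fin N → Finset (Fin m)} {g : Fin m → ℝ}

/-- The triple co-occurrence condition forces the supports of regular samples to contain either all
the large weights or none of them. -/
theorem abs_lt_of_regular (hS : ∀ r, (S r).card ≤ k)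
    (h3 : ∀ i₁ i₂ i₃, ∃ r, Regular k g (S r) ∧ i₁ ∈ S r ∧ i₂ ∈ S r ∧ i₃ ∈ S r)
    {r : Fin N} (hr : Regular k g (S r)) {j : Fin m} (hj : 2 / 5 ≤ |g j|) (hjS : j ∉ S r) :
    ∀ i ∈ S r, |g i| < 2 / 5 := by
  intro i hi
  by_contra! hbig
  have hij : i ≠ j := fun h => hjS (h ▸ hi)
  by_cases hex : ∃ l ∈ S r, l ≠ i ∧ 2 / 5 ≤ |g l|
  · obtain ⟨l, hl, hli, hlbig⟩ := hex
    have hlj : l ≠ j := fun h => hjS (h ▸ hl)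
    obtain ⟨r', hr', h1, h2, h4⟩ := h3 i j l
    have := hr'.sum_abs_le (T := {i, j, l}) (by
      intro x hx; simp only [Finset.mem_insert, Finset.mem_singleton] at hx
      rcases hx with rfl | rfl | rfl <;> assumption) Finset.card_le_three
    rw [Finset.sum_insert (by simp [hij, hli.symm]), Finset.sum_pair hlj.symm] at this
    linarith
  · push Not at hex
    have h5 := hr.lt_abs (hS r) hi hex hbig
    obtain ⟨r', hr', h1, h2, _⟩ := h3 i j j
    have := hr'.sum_abs_le (T := {i, j}) (by
      intro x hx; simp only [Finset.mem_insert, Finset.mem_singleton] at hx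
      rcases hx with rfl | rfl <;> assumption) (Finset.card_le_two.trans (by norm_num))
    rw [Finset.sum_pair hij] at this
    linarith

/-- A sample on which the behaviour of the decoder `g` is understood. -/
def Good (k : ℕ) (g : Fin m → ℝ) (S : Finset (Fin m)) (v : Fin m → Bool) : Prop :=
  Regular k g S ∧ Robust g S v

theorem Good.rnd_of_ne_zero (hS : ∀ r, (S r).card ≤ k)
    (h3 : ∀ i₁ i₂ i₃, ∃ r, Regular k g (S r) ∧ i₁ ∈ S r ∧ i₂ ∈ S r ∧ i₃ ∈ S r)
    {r : Fin N} {v : Fin m → Bool} (hr : Good k g (S r) v) {j : Fin m} (hj : 2 / 5 ≤ |g j|)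
    (hne : rnd (signedSum g (S r) v) ≠ 0) :
    (rnd (signedSum g (S r) v) : ℝ) = (SignType.sign (g j) : ℝ) * sgn (v j) := by
  by_cases hjS : j ∈ S r
  · exact (hr.2.rnd_eq_zero_or hjS hj).resolve_left hne
  · exact absurd (hr.2.rnd_eq_zero (abs_lt_of_regular hS h3 hr.1 hj hjS)) hne

/-- A decoder with exactly one large weight decodes the corresponding coefficient up to sign. -/
theorem Good.rnd_eq_of_unique (hS : ∀ r, (S r).card ≤ k)
    (h3 : ∀ i₁ i₂ i₃, ∃ r, Regular k g (S r) ∧ i₁ ∈ S r ∧ i₂ ∈ S r ∧ i₃ ∈ S r)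
    {r : Fin N} {v : Fin m → Bool} (hr : Good k g (S r) v) {j : Fin m} (hj : 2 / 5 ≤ |g j|)
    (huniq : ∀ i, i ≠ j → |g i| < 2 / 5) :
    (rnd (signedSum g (S r) v) : ℝ) = (SignType.sign (g j) : ℝ) * coeff (S r) v j := by
  by_cases hjS : j ∈ S r
  · rw [hr.2.rnd_eq_of_large hjS (hr.1.lt_abs (hS r) hjS (fun i _ => huniq i) hj)]
    simp [coeff, hjS]
  · rw [hr.2.rnd_eq_zero (abs_lt_of_regular hS h3 hr.1 hj hjS)]
    simp [coeff, hjS]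

/-- Decoders of `m` signals any two of which agree and disagree in sign often enough decode, up to
signs and a permutation, the coefficients. The sets of large weights of the `m` decoders are nonempty
and pairwise disjoint subsets of an `m`-element set, hence singletons. -/
theorem exists_perm_of_decoders {g : Fin m → Fin m → ℝ} {v : Fin N → Fin m → Bool}
    {X : Fin m → Fin N → SignType} {R : Fin N → Prop} {b : ℝ} (hm : 2 ≤ m)
    (hS : ∀ r, (S r).card ≤ k)
    (hbad : ∀ i, (count fun r => ¬ Good k (g i) (S r) (v r)) ≤ b)
    (h3 : ∀ i₁ i₂ i₃, b < count fun r => i₁ ∈ S r ∧ i₂ ∈ S r ∧ i₃ ∈ S r)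
    (hX : ∀ i r, R r → |signedSum (g i) (S r) (v r) - (X i r : ℝ)| ≤ 1 / 10)
    (hpair : ∀ i j, i ≠ j → ∀ s : SignType, s ≠ 0 →
      2 * b < count fun r => R r ∧ X i r * X j r = s) :
    ∃ (π : Equiv.Perm (Fin m)) (σ : Fin m → ℝ), (∀ i, σ i = 1 ∨ σ i = -1) ∧
      ∀ i r, R r → Good k (g i) (S r) (v r) → (X i r : ℝ) = σ i * coeff (S r) (v r) (π i) := by
  have hrnd : ∀ i r, R r → rnd (signedSum (g i) (S r) (v r)) = X i r := fun i r hr =>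
    rnd_eq (hX i r hr)
  have h3' : ∀ i, ∀ i₁ i₂ i₃, ∃ r, Regular k (g i) (S r) ∧ i₁ ∈ S r ∧ i₂ ∈ S r ∧ i₃ ∈ S r := by
    intro i i₁ i₂ i₃
    obtain ⟨r, hr, hr'⟩ := exists_and_not_of_count_lt ((hbad i).trans_lt (h3 i₁ i₂ i₃))
    exact ⟨r, (not_not.1 hr').1, hr⟩
  have hgood2 : ∀ i j, i ≠ j → ∀ s : SignType, s ≠ 0 → ∃ r, R r ∧ X i r * X j r = s ∧
      Good k (g i) (S r) (v r) ∧ Good k (g j) (S r) (v r) := by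
    intro i j hij s hs
    obtain ⟨r, hr, hr'⟩ := exists_and_not_of_count_lt (lt_of_le_of_lt
      ((count_or_le _ _).trans ((add_le_add (hbad i) (hbad j)).trans_eq (two_mul b).symm))
      (hpair i j hij s hs))
    rw [not_or, not_not, not_not] at hr'
    exact ⟨r, hr.1, hr.2, hr'⟩
  have hne : ∀ i, ∃ j, 2 / 5 ≤ |g i j| := by
    intro i
    by_contra! hsmall
    obtain ⟨j, hj⟩ : ∃ j, i ≠ j := by
      have : Nontrivial (Fin m) := Fin.nontrivial_iff_two_le.2 hm
      obtain ⟨j, hj⟩ := exists_ne i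
      exact ⟨j, hj.symm⟩
    obtain ⟨r, hR, hr, hgi, _⟩ := hgood2 i j hj 1 (by decide)
    rw [← hrnd i r hR, hgi.2.rnd_eq_zero fun l _ => hsmall l, zero_mul] at hr
    exact absurd hr (by decide)
  choose p hp using hne
  have hdisj : ∀ i i' j, 2 / 5 ≤ |g i j| → 2 / 5 ≤ |g i' j| → i = i' := by
    intro i i' j h1 h2
    by_contra hii
    have key : ∀ s : SignType, s ≠ 0 →
        (s : ℝ) = (SignType.sign (g i j) : ℝ) * (SignType.sign (g i' j) : ℝ) := by
      intro s hs
      obtain ⟨r, hR, hr, hgi, hgi'⟩ := hgood2 i i' hii s hs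
      have hn : X i r ≠ 0 := fun h => hs (by rw [← hr, h, zero_mul])
      have hn' : X i' r ≠ 0 := fun h => hs (by rw [← hr, h, mul_zero])
      rw [← hrnd i r hR] at hn
      rw [← hrnd i' r hR] at hn'
      have e1 := hgi.rnd_of_ne_zero hS (h3' i) h1 hn
      have e2 := hgi'.rnd_of_ne_zero hS (h3' i') h2 hn'
      rw [← hr, SignType.coe_mul, ← hrnd i r hR, ← hrnd i' r hR, e1, e2]
      linear_combination (SignType.sign (g i j) : ℝ) * (SignType.sign (g i' j) : ℝ)
        * sgn_mul_self (v r j)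
    have k1 := key 1 (by decide)
    have k2 := key (-1) (by decide)
    rw [← k1] at k2
    norm_num at k2
  have hinj : Function.Injective p := fun i i' h => hdisj i i' (p i) (hp i) (h ▸ hp i')
  have huniq : ∀ i j, j ≠ p i → |g i j| < 2 / 5 := by
    intro i j hj
    by_contra! hbig
    obtain ⟨i', rfl⟩ := (Finite.injective_iff_surjective.1 hinj) j
    exact hj (by rw [hdisj i i' (p i') hbig (hp i')])
  refine ⟨Equiv.ofBijective p (Finite.injective_iff_bijective.1 hinj),
    fun i => SignType.sign (g i (p i)), fun i => ?_, fun i r hR hgood => ?_⟩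
  · rcases lt_trichotomy (g i (p i)) 0 with h | h | h
    · right; simp [sign_neg h]
    · have := hp i; rw [h] at this; norm_num at this
    · left; simp [sign_pos h]
  · rw [← hrnd i r hR]
    exact hgood.rnd_eq_of_unique hS (h3' i) (hp i) (huniq i)

/-- A dictionary that explains almost all samples with coefficients which are a signed permutation of
the true ones is the true dictionary up to this signed permutation. -/
theorem apply_perm_eq_of_explains {n : ℕ} {A B : Matrix (Fin n) (Fin m) ℝ}
    {v : Fin N → Fin m → Bool} {x : Fin N → Fin m → ℝ} {G : Fin N → Prop} {c : ℝ}
    {π : Equiv.Perm (Fin m)} {σ : Fin m → ℝ}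
    (hx : ∀ r, G r → ∀ i, x r i = σ i * coeff (S r) (v r) (π i))
    (hB : ∀ r, G r → A *ᵥ coeff (S r) (v r) = B *ᵥ x r)
    (hG : (count fun r => ¬ G r) < c)
    (hrank : ∀ u : Fin m → ℝ, u ≠ 0 → c ≤ count fun r => ∑ i, u i * coeff (S r) (v r) i ≠ 0)
    (a : Fin n) (i : Fin m) : A a (π i) = σ i * B a i := by
  set u : Fin m → ℝ := fun j => A a j - σ (π.symm j) * B a (π.symm j) with hu
  have hu0 : u = 0 := by
    by_contra hne
    refine absurd ((hrank u hne).trans (count_mono fun r hr => ?_)) (not_le.2 hG)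
    intro hGr
    apply hr
    have h1 := congrFun (hB r hGr) a
    simp only [Matrix.mulVec, dotProduct] at h1
    have h2 : ∑ j, σ (π.symm j) * B a (π.symm j) * coeff (S r) (v r) j = ∑ i, B a i * x r i := by
      rw [← Equiv.sum_comp π]
      refine Finset.sum_congr rfl fun i _ => ?_
      rw [hx r hGr, Equiv.symm_apply_apply]
      ring
    simp only [hu, sub_mul]
    rw [Finset.sum_sub_distrib, h2, h1, sub_self]
  have := congrFun hu0 (π i)
  simp only [hu, Equiv.symm_apply_apply, Pi.zero_apply] at this
  linarith

end Coefficients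

/-! ### Typical signs -/

section Typical

variable {n m k N : ℕ}

/-- The index set of the grid of mesh `1 / M` in the cube `[-2, 2]ⁿ`. -/
abbrev Grid (n M : ℕ) : Type := Fin n → Fin (4 * M + 1)

/-- The point of the grid with a given index. -/
noncomputable def gridPoint {M : ℕ} (z : Grid n M) (a : Fin n) : ℝ := ((z a : ℕ) : ℝ) / M - 2

theorem exists_gridPoint_near {M : ℕ} (hM : 0 < M) {w : Fin n → ℝ} (hw : ∀ a, |w a| ≤ 2) :
    ∃ z : Grid n M, ∀ a, |gridPoint z a - w a| ≤ 1 / M := by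
  have hM' : (0 : ℝ) < M := by exact_mod_cast hM
  have h0 : ∀ a, 0 ≤ (w a + 2) * M := fun a =>
    mul_nonneg (by linarith [(abs_le.1 (hw a)).1]) hM'.le
  have h1 : ∀ a, ⌊(w a + 2) * M⌋₊ < 4 * M + 1 := fun a => by
    rw [Nat.lt_succ_iff]
    apply Nat.floor_le_of_le
    push_cast
    have := (abs_le.1 (hw a)).2
    nlinarith
  refine ⟨fun a => ⟨_, h1 a⟩, fun a => ?_⟩
  have h2 := Nat.floor_le (h0 a)
  have h3 := Nat.lt_floor_add_one ((w a + 2) * M)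
  have h4 : gridPoint (fun a => ⟨_, h1 a⟩) a - w a
      = ((⌊(w a + 2) * M⌋₊ : ℝ) - (w a + 2) * M) / M := by
    simp only [gridPoint]; field_simp; ring
  rw [h4, abs_div, abs_of_pos hM']
  refine div_le_div_of_nonneg_right ?_ hM'.le
  rw [abs_le]; constructor <;> linarith

/-- The inner products of a vector with the columns of `A`. -/
def weights (A : Matrix (Fin n) (Fin m) ℝ) (z : Fin n → ℝ) (j : Fin m) : ℝ := ∑ a, A a j * z a

/-- The properties of the random signs on which the recovery relies; `q` is a lower bound for the
number of samples containing a given triple, `t` is the number of samples on which decoding may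
fail. -/
structure Typical (A : Matrix (Fin n) (Fin m) ℝ) (S : Fin N → Finset (Fin m)) (k M : ℕ) (q t : ℝ)
    (v : Fin N → Fin m → Bool) : Prop where
  /-- A grid point whose inner products with nearly all samples are close to `0` or `±1` is
  well-behaved on nearly all samples. -/
  decoder : ∀ z : Grid n M,
    (count fun r => ¬ Near (signedSum (weights A (gridPoint z)) (S r) (v r))) ≤ t →
      (count fun r => ¬ Good k (weights A (gridPoint z)) (S r) (v r)) ≤ 50 * (k + 1) * t
  /-- Any two coefficients often agree and often disagree in sign. -/
  pair : ∀ i j, i ≠ j → ∀ s : SignType, s ≠ 0 →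
    q / 8 ≤ count fun r => (i ∈ S r ∧ j ∈ S r) ∧ sgn (v r i) * sgn (v r j) = (s : ℝ)
  /-- The coefficient vectors span robustly, even modulo `3`. -/
  rank : ∀ u : Fin m → ZMod 3, u ≠ 0 →
    q / 8 ≤ count fun r => ∑ i, u i * coeffMod (S r) (v r) i ≠ 0
  /-- Some grid points decode the true coefficients on nearly all samples. -/
  decode : ∃ z : Fin m → Grid n M, (count fun r => ¬ ∀ i,
    |signedSum (weights A (gridPoint (z i))) (S r) (v r) - coeff (S r) (v r) i| ≤ 1 / 10) ≤ t

variable {S : Fin N → Finset (Fin m)}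

theorem count_not_regular_le (g : Fin m → ℝ) :
    (count fun r => ¬ Regular k g (S r)) ≤ 8 * (k + 1) * ∑ r, failure g (S r) := by
  classical
  rw [count_eq_sum, Finset.mul_sum]
  refine Finset.sum_le_sum fun r _ => ?_
  by_cases h : Regular k g (S r)
  · have : 0 ≤ failure g (S r) := prob_nonneg fun v => ¬ Near (signedSum g (S r) v)
    rw [if_neg (not_not.2 h)]
    positivity
  · rw [if_pos h]
    exact not_lt.1 h

/-- A fixed decoder is unlikely to work on nearly all of the samples unless it is well-behaved. -/
theorem prob_decoder_le (hS : ∀ r, (S r).card ≤ k) (g : Fin m → ℝ) {t : ℝ} (ht : 0 ≤ t) :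
    prob (fun v : Fin N → Fin m → Bool =>
      (count fun r => ¬ Near (signedSum g (S r) (v r))) ≤ t ∧
        50 * (k + 1) * t < count fun r => ¬ Good k g (S r) (v r)) ≤ Real.exp (-t) := by
  have hk : (0 : ℝ) ≤ k := Nat.cast_nonneg k
  rcases le_total (4 * t) (∑ r, failure g (S r)) with h | h
  · refine (prob_mono fun v hv => ?_).trans
      ((prob_count_le_quarter fun r v => ¬ Near (signedSum g (S r) v)).trans
        (Real.exp_le_exp.2 ?_))
    · refine hv.1.trans ?_
      change t ≤ (∑ r, failure g (S r)) / 4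
      linarith
    · change -((∑ r, failure g (S r)) / 4) ≤ -t
      linarith
  · have hrob : ∑ r, prob (fun v => ¬ Robust g (S r) v) ≤ (2 * k + 1) * (4 * t) := by
      refine le_trans ?_ (mul_le_mul_of_nonneg_left h (by positivity))
      rw [Finset.mul_sum]
      refine Finset.sum_le_sum fun r _ => (prob_not_robust_le g (S r)).trans
        (mul_le_mul_of_nonneg_right ?_ (prob_nonneg _))
      have : ((S r).card : ℝ) ≤ k := by exact_mod_cast hS r
      push_cast; linarith
    refine (prob_mono fun v hv => ?_).trans
      (prob_two_mul_add_le_count (fun r v => ¬ Robust g (S r) v) t)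
    have h1 : (count fun r => ¬ Good k g (S r) (v r))
        ≤ (count fun r => ¬ Regular k g (S r)) + count fun r => ¬ Robust g (S r) (v r) :=
      (count_mono fun r hr => by unfold Good at hr; tauto).trans (count_or_le _ _)
    have h2 := (count_not_regular_le (k := k) (S := S) g).trans
      (mul_le_mul_of_nonneg_left h (by positivity))
    have h3 := hv.2
    nlinarith [mul_nonneg hk ht]

/-- Independent events, `q` of which have probability at least one half. -/
theorem prob_count_lt_le {α : Type*} [Fintype α] [Nonempty α] {E : Fin N → α → Prop}
    {P : Fin N → Prop} {q : ℝ} (hq : q ≤ count P) (hE : ∀ r, P r → 1 / 2 ≤ prob (E r)) :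
    prob (fun v : Fin N → α => ¬ q / 8 ≤ count fun r => E r (v r)) ≤ Real.exp (-(q / 8)) := by
  classical
  have h : q / 2 ≤ ∑ r, prob (E r) := by
    have h1 : count P / 2 ≤ ∑ r, prob (E r) := by
      rw [count_eq_sum, Finset.sum_div]
      refine Finset.sum_le_sum fun r _ => ?_
      split_ifs with hr
      · exact hE r hr
      · simpa using prob_nonneg (E r)
    linarith
  refine (prob_mono fun v hv => ?_).trans ((prob_count_le_quarter E).trans (Real.exp_le_exp.2 ?_))
  · rw [not_le] at hv; linarith
  · linarith

/-- Random signs are typical with high probability. -/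
theorem prob_not_typical_le {A : Matrix (Fin n) (Fin m) ℝ} {δ : ℝ} {M : ℕ} {q t : ℝ}
    (hA : IsRIP A k δ) (hδ : 0 < δ) (hδ1 : δ ≤ 1) (hk : 2 ≤ k) (hS : ∀ r, (S r).card ≤ k)
    (h3 : ∀ i₁ i₂ i₃, q ≤ count fun r => i₁ ∈ S r ∧ i₂ ∈ S r ∧ i₃ ∈ S r)
    (hM : 0 < M) (hMk : 100 * (n * k) ≤ (M : ℝ)) (ht : 0 ≤ t)
    (htδ : N * (m * (2 * Real.exp (-(1 / (5625 * δ ^ 2))))) ≤ t / 4) :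
    prob (fun v => ¬ Typical A S k M q t v) ≤
      (4 * M + 1) ^ n * Real.exp (-t) + m * (m * (3 * Real.exp (-(q / 8))))
        + 3 ^ m * Real.exp (-(q / 8)) + Real.exp (-(t / 2)) := by
  choose z hz using fun i : Fin m => exists_gridPoint_near (n := n) hM
    (fun a => hA.abs_apply_le hδ.le hδ1 (by omega) a i)
  set E₁ : (Fin N → Fin m → Bool) → Prop := fun v => ∃ z : Grid n M,
    (count fun r => ¬ Near (signedSum (weights A (gridPoint z)) (S r) (v r))) ≤ t ∧
      50 * (k + 1) * t < count fun r => ¬ Good k (weights A (gridPoint z)) (S r) (v r) with hE₁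
  set E₂ : (Fin N → Fin m → Bool) → Prop := fun v => ∃ i j : Fin m, ∃ s : SignType,
    (i ≠ j ∧ s ≠ 0) ∧ ¬ q / 8 ≤
      count fun r => (i ∈ S r ∧ j ∈ S r) ∧ sgn (v r i) * sgn (v r j) = (s : ℝ) with hE₂
  set E₃ : (Fin N → Fin m → Bool) → Prop := fun v => ∃ u : Fin m → ZMod 3, u ≠ 0 ∧
    ¬ q / 8 ≤ count fun r => ∑ i, u i * coeffMod (S r) (v r) i ≠ 0 with hE₃
  set E₄ : (Fin N → Fin m → Bool) → Prop := fun v => 2 * ∑ r, prob (fun v => ¬ ∀ i,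
    |signedSum (weights A (gridPoint (z i))) (S r) v - coeff (S r) v i| ≤ 1 / 10) + t / 2 ≤
      (count fun r => ¬ ∀ i,
    |signedSum (weights A (gridPoint (z i))) (S r) (v r) - coeff (S r) (v r) i| ≤ 1 / 10) with hE₄
  have b₁ : prob E₁ ≤ (4 * M + 1) ^ n * Real.exp (-t) := by
    refine (prob_exists_le_card_mul _ fun z => prob_decoder_le hS _ ht).trans_eq ?_
    simp
  have b₂ : prob E₂ ≤ m * (m * (3 * Real.exp (-(q / 8)))) := by
    have h2 : ∀ (i j : Fin m) (s : SignType), prob (fun v : Fin N → Fin m → Bool =>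
        (i ≠ j ∧ s ≠ 0) ∧ ¬ q / 8 ≤
          count fun r => (i ∈ S r ∧ j ∈ S r) ∧ sgn (v r i) * sgn (v r j) = (s : ℝ)) ≤
        Real.exp (-(q / 8)) := by
      intro i j s
      by_cases hc : i ≠ j ∧ s ≠ 0
      · refine (prob_mono fun v hv => hv.2).trans
          (prob_count_lt_le (P := fun r => i ∈ S r ∧ j ∈ S r ∧ j ∈ S r)
            (E := fun r (v : Fin m → Bool) => (i ∈ S r ∧ j ∈ S r) ∧
              sgn (v i) * sgn (v j) = (s : ℝ)) (h3 i j j) fun r hr => ?_)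
        refine (half_le_prob_sgn_mul hc.1 (s := (s : ℝ)) ?_).trans
          (prob_mono fun v hv => ⟨⟨hr.1, hr.2.1⟩, hv⟩)
        have := hc.2
        cases s <;> simp at this ⊢
      · have : (fun v : Fin N → Fin m → Bool => (i ≠ j ∧ s ≠ 0) ∧ ¬ q / 8 ≤
            count fun r => (i ∈ S r ∧ j ∈ S r) ∧ sgn (v r i) * sgn (v r j) = (s : ℝ))
            = fun _ => False := by
          funext v; simp only [eq_iff_iff, iff_false]; exact fun h => hc h.1
        rw [this]
        simp [prob, Real.exp_nonneg]
    have := prob_exists_le_card_mul _ fun i => prob_exists_le_card_mul _ fun j =>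
      prob_exists_le_card_mul _ fun s => h2 i j s
    have hcard : Fintype.card SignType = 3 := rfl
    simpa [hE₂, hcard] using this
  have b₃ : prob E₃ ≤ 3 ^ m * Real.exp (-(q / 8)) := by
    refine (prob_exists_le_card_mul (c := Real.exp (-(q / 8))) _ fun u => ?_).trans_eq
      (by rw [Fintype.card_fun, ZMod.card, Fintype.card_fin]; norm_num)
    by_cases hu : u = 0
    · simp [hu, prob, Real.exp_nonneg]
    · obtain ⟨i, hi⟩ := Function.ne_iff.1 hu
      refine (prob_mono fun v hv => hv.2).trans
        (prob_count_lt_le (E := fun r (v : Fin m → Bool) => ∑ i, u i * coeffMod (S r) v i ≠ 0)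
          (h3 i i i) fun r hr => ?_)
      exact half_le_prob_dot_coeffMod_ne_zero hr.1 hi
  have b₄ : prob E₄ ≤ Real.exp (-(t / 2)) :=
    prob_two_mul_add_le_count (fun r v => ¬ ∀ i,
      |signedSum (weights A (gridPoint (z i))) (S r) v - coeff (S r) v i| ≤ 1 / 10) (t / 2)
  have hfail : ∑ r, prob (fun v => ¬ ∀ i,
      |signedSum (weights A (gridPoint (z i))) (S r) v - coeff (S r) v i| ≤ 1 / 10) ≤ t / 4 := by
    have h1 : ∀ r, prob (fun v => ¬ ∀ i,
        |signedSum (weights A (gridPoint (z i))) (S r) v - coeff (S r) v i| ≤ 1 / 10) ≤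
          m * (2 * Real.exp (-(1 / (5625 * δ ^ 2)))) := by
      intro r
      refine (prob_mono fun v hv => not_forall.1 hv).trans
        ((prob_exists_le_card_mul _ fun i => prob_decode_le hA hδ hδ1 hk i (hS r) (hz i) ?_).trans_eq
          (by simp))
      have : (0 : ℝ) < M := by exact_mod_cast hM
      rw [mul_one_div, ← mul_div_assoc]
      exact (div_le_one this).2 hMk
    refine (Finset.sum_le_sum fun r _ => h1 r).trans ?_
    simpa using htδ
  refine (prob_mono (Q := fun v => ((E₁ v ∨ E₂ v) ∨ E₃ v) ∨ E₄ v) fun v hv => ?_).trans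
    ((prob_or_le _ _).trans (add_le_add ((prob_or_le _ _).trans
      (add_le_add ((prob_or_le _ _).trans (add_le_add b₁ b₂)) b₃)) b₄))
  by_contra hc
  push Not at hc
  obtain ⟨⟨⟨c₁, c₂⟩, c₃⟩, c₄⟩ := hc
  refine hv ⟨fun z hz => ?_, fun i j hij s hs => ?_, fun u hu => ?_, z, ?_⟩
  · by_contra h; exact c₁ ⟨z, hz, not_le.1 h⟩
  · by_contra h; exact c₂ ⟨i, j, s, ⟨hij, hs⟩, h⟩
  · by_contra h; exact c₃ ⟨u, hu, h⟩
  · by_contra h; refine c₄ ?_; simp only [hE₄]; linarith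

end Typical

/-! ### Exhaustive search for an explanation of the samples -/

section Search

variable {n m k N M : ℕ}

/-- A candidate explanation of the samples: one decoder for every column, the decoded signals, and
the set of samples that are explained. -/
abbrev Candidate (n m N M : ℕ) : Type :=
  (Fin m → Grid n M) × (Fin m → Fin N → SignType) × Finset (Fin N)

/-- The columns of `W` form a right inverse of the matrix of signals `X` restricted to `R`. -/
def IsRightInverse (X : Fin m → Fin N → SignType) (R : Finset (Fin N)) (W : Fin N → Fin m → ℝ) :
    Prop :=
  ∀ i j, ∑ r ∈ R, (X i r : ℝ) * W r j = if i = j then 1 else 0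

theorem exists_isRightInverse {X : Fin m → Fin N → SignType} {R : Finset (Fin N)}
    (h : ∀ u : Fin m → ℝ, (∀ r ∈ R, ∑ i, u i * (X i r : ℝ) = 0) → u = 0) :
    ∃ W, IsRightInverse X R W := by
  let L : (Fin m → ℝ) →ₗ[ℝ] (Fin N → ℝ) :=
    { toFun := fun u r => if r ∈ R then ∑ i, u i * (X i r : ℝ) else 0
      map_add' := fun u w => by
        ext r
        by_cases hr : r ∈ R <;> simp [hr, add_mul, Finset.sum_add_distrib]
      map_smul' := fun c u => by
        ext r
        by_cases hr : r ∈ R <;> simp [hr, Finset.mul_sum, mul_assoc] }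
  have hL : LinearMap.ker L = ⊥ := by
    rw [LinearMap.ker_eq_bot']
    refine fun u hu => h u fun r hr => ?_
    have := congrFun hu r
    simpa [L, hr] using this
  obtain ⟨L', hL'⟩ := L.exists_leftInverse_of_injective hL
  refine ⟨fun r => L' (Pi.single r 1), fun i j => ?_⟩
  have h1 : L (Pi.single i 1) = ∑ r ∈ R, (X i r : ℝ) • (Pi.single r 1 : Fin N → ℝ) := by
    ext r
    have : ∑ l, (Pi.single i (1 : ℝ) : Fin m → ℝ) l * (X l r : ℝ) = X i r := by
      rw [Finset.sum_eq_single i] <;> simp +contextual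
    have hLr : L (Pi.single i 1) r = if r ∈ R then (X i r : ℝ) else 0 := by
      change (if r ∈ R then _ else 0) = _
      rw [this]
    rw [hLr]
    simp only [Finset.sum_apply, Pi.smul_apply, Pi.single_apply, smul_eq_mul, mul_ite, mul_one,
      mul_zero, Finset.sum_ite_eq]
  have h2 := congrFun (LinearMap.congr_fun hL' (Pi.single i 1)) j
  rw [LinearMap.comp_apply, h1, map_sum] at h2
  simp only [map_smul, Finset.sum_apply, Pi.smul_apply, smul_eq_mul, LinearMap.id_apply,
    Pi.single_apply] at h2
  rw [h2]
  simp only [eq_comm]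

open scoped Classical in
/-- A right inverse of the matrix of signals, if there is one. -/
noncomputable def rightInverse (X : Fin m → Fin N → SignType) (R : Finset (Fin N)) :
    Fin N → Fin m → ℝ :=
  if h : ∃ W, IsRightInverse X R W then h.choose else 0

theorem isRightInverse_rightInverse {X : Fin m → Fin N → SignType} {R : Finset (Fin N)}
    (h : ∃ W, IsRightInverse X R W) : IsRightInverse X R (rightInverse X R) := by
  rw [rightInverse, dif_pos h]
  exact h.choose_spec

/-- The dictionary computed from the samples `y` by means of a candidate. -/
noncomputable def Candidate.dict (c : Candidate n m N M) (y : Fin N × Fin n → ℝ) :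
    Matrix (Fin n) (Fin m) ℝ :=
  Matrix.of fun a i => ∑ r ∈ c.2.2, y (r, a) * rightInverse c.2.1 c.2.2 r i

/-- The entries of the dictionary of a candidate, as linear polynomials in the samples. -/
noncomputable def Candidate.dictPoly (c : Candidate n m N M) (p : Fin n × Fin m) :
    MvPolynomial (Fin N × Fin n) ℝ :=
  ∑ r ∈ c.2.2, MvPolynomial.X (r, p.1) * MvPolynomial.C (rightInverse c.2.1 c.2.2 r p.2)

theorem Candidate.eval_dictPoly (c : Candidate n m N M) (p : Fin n × Fin m)
    (y : Fin N × Fin n → ℝ) : MvPolynomial.eval y (c.dictPoly p) = c.dict y p.1 p.2 := by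
  simp [Candidate.dictPoly, Candidate.dict]

/-- The conditions on a candidate that do not involve the samples: few samples are left
unexplained, and any two signals often agree and often disagree in sign. -/
def Candidate.Admissible (c : Candidate n m N M) (q t : ℝ) : Prop :=
  (count fun r => r ∉ c.2.2) ≤ t ∧
    ∀ i j, i ≠ j → ∀ s : SignType, s ≠ 0 →
      q / 16 ≤ count fun r => r ∈ c.2.2 ∧ c.2.1 i r * c.2.1 j r = s

/-- The candidate is admissible, its decoders yield its signals, and its dictionary explains the
samples exactly. -/
def Candidate.Valid (c : Candidate n m N M) (q t : ℝ) (y : Fin N × Fin n → ℝ) : Prop :=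
  c.Admissible q t ∧
    (∀ i r, r ∈ c.2.2 → |∑ a, gridPoint (c.1 i) a * y (r, a) - (c.2.1 i r : ℝ)| ≤ 1 / 10) ∧
    ∀ r a, r ∈ c.2.2 → |∑ i, c.dict y a i * (c.2.1 i r : ℝ) - y (r, a)| ≤ 0

theorem Candidate.testable_valid {κ : Type} (c : Candidate n m N M) (q t : ℝ) :
    Testable κ (c.Valid q t) := by
  refine (testable_const _).and (Testable.and ?_ ?_)
  · refine testable_forall fun i => testable_forall fun r => testable_imp _ ?_
    refine (testable_abs_le (∑ a, MvPolynomial.C (gridPoint (c.1 i) a) * MvPolynomial.X (r, a)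
      - MvPolynomial.C (c.2.1 i r : ℝ)) (1 / 10)).congr fun y => ?_
    simp
  · refine testable_forall fun r => testable_forall fun a => testable_imp _ ?_
    refine (testable_abs_le (∑ i, c.dictPoly (a, i) * MvPolynomial.C (c.2.1 i r : ℝ)
      - MvPolynomial.X (r, a)) 0).congr fun y => ?_
    simp only [map_sub, map_sum, map_mul, MvPolynomial.eval_C, MvPolynomial.eval_X,
      Candidate.eval_dictPoly]

variable {A : Matrix (Fin n) (Fin m) ℝ} {S : Fin N → Finset (Fin m)} {q t : ℝ}
  {v : Fin N → Fin m → Bool}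

theorem sum_mul_samples (z : Fin n → ℝ) (r : Fin N) :
    ∑ a, z a * samples A (fun r => coeff (S r) (v r)) (r, a)
      = signedSum (weights A z) (S r) (v r) := by
  simp only [samples, Matrix.mulVec, dotProduct, signedSum, weights, Finset.mul_sum, Finset.sum_mul]
  rw [Finset.sum_comm, ← Finset.sum_subset (Finset.subset_univ (S r))]
  · refine Finset.sum_congr rfl fun j hj => Finset.sum_congr rfl fun a _ => ?_
    simp only [coeff, hj, if_true]
    ring
  · intro j _ hj
    simp [coeff, hj]

/-- The true coefficients as elements of `{-1, 0, 1}`. -/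
def coeffSign (S : Finset (Fin m)) (v : Fin m → Bool) (i : Fin m) : SignType :=
  if i ∈ S then (if v i then 1 else -1) else 0

theorem coe_coeffSign (S : Finset (Fin m)) (v : Fin m → Bool) (i : Fin m) :
    (coeffSign S v i : ℝ) = coeff S v i := by
  unfold coeffSign coeff sgn
  split_ifs <;> simp

/-- For typical signs the true dictionary belongs to a valid candidate. -/
theorem Typical.exists_valid (h : Typical A S k M q t v) (htq : t < q / 16) (hq : 0 < q) :
    ∃ c : Candidate n m N M, c.Valid q t (samples A fun r => coeff (S r) (v r)) := by
  classical
  obtain ⟨z, hz⟩ := h.decode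
  set R : Finset (Fin N) := Finset.univ.filter fun r => ∀ i,
    |signedSum (weights A (gridPoint (z i))) (S r) (v r) - coeff (S r) (v r) i| ≤ 1 / 10 with hR
  set X : Fin m → Fin N → SignType := fun i r => coeffSign (S r) (v r) i with hX
  have hRt : (count fun r => r ∉ R) ≤ t := by simpa [hR] using hz
  have hinv : IsRightInverse X R (rightInverse X R) := by
    refine isRightInverse_rightInverse (exists_isRightInverse fun u hu => ?_)
    by_contra hne
    have h1 := count_dot_ne_zero_of_mod_three h.rank hne
    obtain ⟨r, hr, hrR⟩ := exists_and_not_of_count_lt (P := fun r =>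
      ∑ i, u i * coeff (S r) (v r) i ≠ 0) (Q := fun r => r ∉ R) (by linarith)
    apply hr
    simpa [hX, coe_coeffSign] using hu r (not_not.1 hrR)
  have hdict : Candidate.dict (z, X, R) (samples A fun r => coeff (S r) (v r)) = A := by
    ext a i
    simp only [Candidate.dict, samples, Matrix.mulVec, dotProduct, Matrix.of_apply, Finset.sum_mul]
    rw [Finset.sum_comm]
    have : ∀ j, ∑ r ∈ R, A a j * coeff (S r) (v r) j * rightInverse X R r i
        = A a j * if j = i then 1 else 0 := by
      intro j
      rw [← hinv j i, Finset.mul_sum]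
      refine Finset.sum_congr rfl fun r _ => ?_
      simp only [hX, coe_coeffSign]; ring
    simp [this]
  refine ⟨(z, X, R), ⟨hRt, fun i j hij s hs => ?_⟩, fun i r hr => ?_, fun r a hr => ?_⟩
  · have h1 := h.pair i j hij s hs
    have h2 : (count fun r => (i ∈ S r ∧ j ∈ S r) ∧ sgn (v r i) * sgn (v r j) = (s : ℝ)) ≤
        (count fun r => r ∈ R ∧ X i r * X j r = s) + count fun r => r ∉ R := by
      refine (count_mono fun r hr => ?_).trans (count_or_le _ _)
      by_cases hrR : r ∈ R
      · refine Or.inl ⟨hrR, ?_⟩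
        have h3 : ((X i r * X j r : SignType) : ℝ) = (s : ℝ) := by
          rw [SignType.coe_mul, ← hr.2]
          simp only [hX, coe_coeffSign, coeff, hr.1.1, hr.1.2, if_true]
        generalize X i r * X j r = s' at h3
        revert h3
        cases s' <;> cases s <;> simp <;> norm_num
      · exact Or.inr hrR
    change q / 16 ≤ count fun r => r ∈ R ∧ X i r * X j r = s
    linarith
  · rw [sum_mul_samples]
    simp only [hX, coe_coeffSign]
    exact (Finset.mem_filter.1 hr).2 i
  · rw [hdict]
    simp only [hX, coe_coeffSign, samples, Matrix.mulVec, dotProduct]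
    simp

/-- For typical signs every valid candidate has the true dictionary, up to signs and a permutation of
the columns. -/
theorem Typical.recoversColumns (h : Typical A S k M q t v) (hm : 2 ≤ m) (hq : 0 < q) (ht : 0 ≤ t)
    (hS : ∀ r, (S r).card ≤ k)
    (h3 : ∀ i₁ i₂ i₃, q ≤ count fun r => i₁ ∈ S r ∧ i₂ ∈ S r ∧ i₃ ∈ S r)
    (htq : m * (50 * (k + 1) * t) ≤ q / 100) {c : Candidate n m N M}
    (hc : c.Valid q t (samples A fun r => coeff (S r) (v r))) {η : ℝ} (hη : 0 ≤ η) :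
    RecoversColumns A (c.dict (samples A fun r => coeff (S r) (v r))) η := by
  obtain ⟨⟨hR, hpair⟩, hdec, hexp⟩ := hc
  set b : ℝ := 50 * (k + 1) * t with hb
  have hm' : (2 : ℝ) ≤ m := by exact_mod_cast hm
  have hk : (0 : ℝ) ≤ k := Nat.cast_nonneg k
  have htb : t ≤ b := by rw [hb]; nlinarith [mul_nonneg hk ht]
  have hbq : b ≤ q / 100 := by nlinarith
  have hdec' : ∀ i r, r ∈ c.2.2 →
      |signedSum (weights A (gridPoint (c.1 i))) (S r) (v r) - (c.2.1 i r : ℝ)| ≤ 1 / 10 :=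
    fun i r hr => by rw [← sum_mul_samples]; exact hdec i r hr
  have hbad : ∀ i, (count fun r => ¬ Good k (weights A (gridPoint (c.1 i))) (S r) (v r)) ≤ b :=
    fun i => h.decoder _ ((count_mono fun r hr hrR => hr ⟨_, hdec' i r hrR⟩).trans hR)
  obtain ⟨π, σ, hσ, hπ⟩ := exists_perm_of_decoders (g := fun i => weights A (gridPoint (c.1 i)))
    (X := c.2.1) (R := fun r => r ∈ c.2.2) hm hS hbad
    (fun i₁ i₂ i₃ => lt_of_lt_of_le (by linarith) (h3 i₁ i₂ i₃)) hdec'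
    (fun i j hij s hs => lt_of_lt_of_le (by linarith) (hpair i j hij s hs))
  have hG : (count fun r => ¬ (r ∈ c.2.2 ∧ ∀ i,
      Good k (weights A (gridPoint (c.1 i))) (S r) (v r))) < q / 8 := by
    have h1 : (count fun r => ¬ (r ∈ c.2.2 ∧ ∀ i,
        Good k (weights A (gridPoint (c.1 i))) (S r) (v r))) ≤ t + m * b := by
      refine (count_mono fun r hr => ?_).trans ((count_or_le (fun r => r ∉ c.2.2)
        (fun r => ∃ i, ¬ Good k (weights A (gridPoint (c.1 i))) (S r) (v r))).trans
        (add_le_add hR ((count_exists_le _).trans ((Finset.sum_le_sum fun i _ => hbad i).trans_eq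
          (by simp)))))
      rwa [not_and_or, not_forall] at hr
    linarith
  have key := apply_perm_eq_of_explains (A := A)
    (B := c.dict (samples A fun r => coeff (S r) (v r))) (x := fun r i => (c.2.1 i r : ℝ))
    (σ := σ) (π := π)
    (fun r hr i => hπ i r hr.1 (hr.2 i)) (fun r hr => funext fun a => by
      have := abs_nonpos_iff.1 (hexp r a hr.1)
      simp only [samples] at this
      simp only [Matrix.mulVec, dotProduct] at this ⊢
      linarith) hG (fun u hu => count_dot_ne_zero_of_mod_three h.rank hu)
  refine ⟨π.symm, fun i => σ (π.symm i), fun i => hσ _, fun i => ?_⟩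
  have hcol : WithLp.toLp 2 ((c.dict (samples A fun r => coeff (S r) (v r))).col (π.symm i))
      - σ (π.symm i) • WithLp.toLp 2 (A.col i) = 0 := by
    ext a
    have h1 := key a (π.symm i)
    rw [Equiv.apply_symm_apply] at h1
    simp only [PiLp.sub_apply, PiLp.smul_apply, Matrix.col_apply, smul_eq_mul, PiLp.zero_apply, h1]
    rcases hσ (π.symm i) with h2 | h2 <;> rw [h2] <;> ring
  rw [hcol, norm_zero]
  exact hη

/-- The search algorithm, depending only on the stated parameters, recovers the dictionary for
typical signs. -/
theorem exists_algorithm (n m k N M : ℕ) (q t : ℝ) (hm : 2 ≤ m) (hq : 0 < q) (ht : 0 ≤ t)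
    (htq : m * (50 * (k + 1) * t) ≤ q / 100) :
    ∃ T : Algorithm (Fin N × Fin n) (Fin n × Fin m),
      ∀ (A : Matrix (Fin n) (Fin m) ℝ) (S : Fin N → Finset (Fin m)) (v : Fin N → Fin m → Bool),
        (∀ r, (S r).card ≤ k) →
        (∀ i₁ i₂ i₃, q ≤ count fun r => i₁ ∈ S r ∧ i₂ ∈ S r ∧ i₃ ∈ S r) →
        Typical A S k M q t v → ∀ η : ℝ, 0 ≤ η →
          RecoversColumns A (Matrix.of fun a i =>
            T.run (samples A fun r => coeff (S r) (v r)) (a, i)) η := by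
  obtain ⟨T, hT⟩ := exists_search (κ := Fin n × Fin m)
    (fun c : Candidate n m N M => c.testable_valid q t) fun c => c.dictPoly
  refine ⟨T, fun A S v hS h3 h η hη => ?_⟩
  have htq' : t < q / 16 := by
    have hm' : (2 : ℝ) ≤ m := by exact_mod_cast hm
    have hk : (0 : ℝ) ≤ k := Nat.cast_nonneg k
    nlinarith [mul_nonneg hk ht, mul_nonneg (mul_nonneg hk ht) (sub_nonneg.2 hm'),
      mul_nonneg ht (sub_nonneg.2 hm')]
  obtain ⟨c, hc, hrun⟩ := hT _ (h.exists_valid htq' hq)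
  have : (Matrix.of fun a i => T.run (samples A fun r => coeff (S r) (v r)) (a, i))
      = c.dict (samples A fun r => coeff (S r) (v r)) := by
    ext a i
    rw [Matrix.of_apply, hrun]
    exact c.eval_dictPoly (a, i) _
  rw [this]
  exact h.recoversColumns hm hq ht hS h3 htq hc hη

end Search

/-! ### The law of the coefficients -/

section Law

/-- A fair coin. -/
noncomputable def coin : Measure Bool :=
  (2⁻¹ : ENNReal) • Measure.dirac true + (2⁻¹ : ENNReal) • Measure.dirac false

instance isProbabilityMeasure_coin : IsProbabilityMeasure coin :=
  ⟨by simp [coin, ENNReal.inv_two_add_inv_two]⟩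

theorem coin_singleton (b : Bool) : coin {b} = 2⁻¹ := by
  cases b <;> simp [coin]

variable {m N : ℕ}

theorem map_coin (S : Finset (Fin m)) (i : Fin m) :
    coin.map (fun b => if i ∈ S then sgn b else 0) = coordLaw S i := by
  by_cases h : i ∈ S
  · simp only [h, if_true, coordLaw, rademacher]
    rw [coin, Measure.map_add _ _ (measurable_of_finite _), Measure.map_smul, Measure.map_smul,
      Measure.map_dirac' (measurable_of_finite _), Measure.map_dirac' (measurable_of_finite _)]
    simp [sgn]
  · simp only [h, if_false, coordLaw]
    rw [Measure.map_const, measure_univ, one_smul]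

theorem map_coins (S : Fin N → Finset (Fin m)) :
    (Measure.pi fun _ : Fin N => Measure.pi fun _ : Fin m => coin).map
      (fun v r => coeff (S r) (v r)) = coeffLaw S := by
  have h1 : ∀ r, (Measure.pi fun _ : Fin m => coin).map (fun v => coeff (S r) v)
      = Measure.pi fun i => coordLaw (S r) i := by
    intro r
    simp only [← map_coin]
    rw [← Measure.pi_map_pi fun i => (measurable_of_finite _).aemeasurable]
    rfl
  rw [coeffLaw]
  simp only [← h1]
  have : ∀ r, SigmaFinite ((Measure.pi fun _ : Fin m => coin).map (fun v => coeff (S r) v)) := by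
    intro r; rw [h1]; infer_instance
  rw [← Measure.pi_map_pi fun r => (measurable_of_finite _).aemeasurable]

theorem pi_coins_real (P : (Fin N → Fin m → Bool) → Prop) :
    (Measure.pi fun _ : Fin N => Measure.pi fun _ : Fin m => coin).real {v | P v} = prob P := by
  classical
  set μ := Measure.pi fun _ : Fin N => Measure.pi fun _ : Fin m => coin with hμ
  have h1 : ∀ v, μ.real {v} = ((2 : ℝ)⁻¹ ^ m) ^ N := by
    intro v
    rw [Measure.real, hμ, Measure.pi_singleton]
    simp [Measure.pi_singleton, coin_singleton]
  have h2 : {v | P v} = ((Finset.univ.filter P : Finset _) : Set (Fin N → Fin m → Bool)) := by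
    ext; simp
  rw [h2, ← sum_measureReal_singleton]
  simp only [h1]
  rw [Finset.sum_const, nsmul_eq_mul, prob]
  simp [div_eq_mul_inv]

theorem prob_le_coeffLaw_real (S : Fin N → Finset (Fin m)) (P : (Fin N → Fin m → ℝ) → Prop) :
    prob (fun v : Fin N → Fin m → Bool => P fun r => coeff (S r) (v r)) ≤
      (coeffLaw S).real {x | P x} := by
  rw [← pi_coins_real, ← map_coins]
  have : IsProbabilityMeasure ((Measure.pi fun _ : Fin N => Measure.pi fun _ : Fin m => coin).map
      (fun (v : Fin N → Fin m → Bool) r => coeff (S r) (v r))) := by rw [map_coins]; infer_instance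
  refine ENNReal.toReal_mono (measure_ne_top _ _) ?_
  exact Measure.le_map_apply (measurable_of_finite _).aemeasurable {x | P x}

end Law

/-! ### Choice of the parameters -/


theorem lt_log_of_two_le {m : ℕ} (hm : 2 ≤ m) : 69 / 100 < Real.log m := by
  have h1 := Real.log_two_gt_d9
  have h2 : Real.log 2 ≤ Real.log m := Real.log_le_log (by norm_num) (by exact_mod_cast hm)
  linarith

/-- The constant factor `e⁻²` in `κ₀` makes `log (1 / κ₀)` bounded below, also for `m = 2`, where
`log (log m)` is negative. -/
theorem le_log_one_div {m : ℕ} (hm : 2 ≤ m) {q₀ : ℝ} (hq : 0 < q₀) :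
    1 - Real.log q₀ ≤ Real.log (1 / (Real.exp (-2) * Real.log m ^ (-1 : ℝ) * q₀)) := by
  have hl := lt_log_of_two_le hm
  have hl0 : 0 < Real.log m := by linarith
  have h1 : -1 ≤ Real.log (Real.log m) := by
    rw [Real.le_log_iff_exp_le hl0]
    have := Real.exp_neg_one_lt_d9
    linarith
  rw [one_div, Real.log_inv, Real.log_mul (by positivity) hq.ne',
    Real.log_mul (by positivity) (by positivity), Real.log_exp, Real.log_rpow hl0]
  linarith

/-- The failure probabilities of the four parts of `Typical` add up to at most `exp (-n)`. -/
theorem failure_sum_le {n m k : ℕ} {q t : ℝ} (hn : 1 ≤ n) (hm : 2 ≤ m)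
    (ht : 100 * n * Real.log m ≤ t) (hq : q = 5000 * (k + 1) * m * t) :
    (4 * ((400 * m ^ 2 : ℕ) : ℝ) + 1) ^ n * Real.exp (-t) + m * (m * (3 * Real.exp (-(q / 8))))
        + 3 ^ m * Real.exp (-(q / 8)) + Real.exp (-(t / 2)) ≤ Real.exp (-n) := by
  have hl := lt_log_of_two_le hm
  have hn' : (1 : ℝ) ≤ n := by exact_mod_cast hn
  have hm' : (2 : ℝ) ≤ m := by exact_mod_cast hm
  have hm0 : (0 : ℝ) < m := by linarith
  have hk : (0 : ℝ) ≤ k := Nat.cast_nonneg k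
  have hnl : 69 / 100 * n ≤ n * Real.log m := by nlinarith
  have hln : Real.log m ≤ n * Real.log m := by nlinarith
  have ht1 : 69 ≤ t := by nlinarith
  have hqt : 625 * m * t ≤ q / 8 := by
    rw [hq]
    nlinarith [mul_nonneg hk (mul_nonneg hm0.le (by linarith : 0 ≤ t))]
  have hmt : 2 * m + t ≤ q / 8 := by nlinarith [mul_nonneg (sub_nonneg.2 hm') (sub_nonneg.2 ht1)]
  have hexp : ∀ j : ℕ, (m : ℝ) ^ j = Real.exp (j * Real.log m) := fun j => by
    rw [Real.exp_nat_mul, Real.exp_log hm0]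
  have hpow : ∀ j : ℕ, (2 : ℝ) ^ j ≤ m ^ j := fun j => pow_le_pow_left₀ (by norm_num) hm' j
  have b₁ : (4 * ((400 * m ^ 2 : ℕ) : ℝ) + 1) ^ n * Real.exp (-t) ≤ Real.exp (-(n + 2)) := by
    have h1 : 4 * ((400 * m ^ 2 : ℕ) : ℝ) + 1 ≤ (m : ℝ) ^ 13 := by
      have h2 := hpow 11
      push_cast
      have h3 : (m : ℝ) ^ 13 = m ^ 11 * m ^ 2 := by ring
      rw [h3]
      nlinarith [sq_nonneg (m : ℝ)]
    have h4 := pow_le_pow_left₀ (by positivity) h1 n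
    rw [hexp, ← Real.exp_nat_mul] at h4
    refine (mul_le_mul_of_nonneg_right h4 (Real.exp_nonneg _)).trans ?_
    rw [← Real.exp_add]
    apply Real.exp_le_exp.2
    push_cast
    nlinarith
  have b₂ : m * (m * (3 * Real.exp (-(q / 8)))) ≤ Real.exp (-(n + 2)) := by
    have h1 : (m : ℝ) * m * 3 ≤ m ^ 4 := by
      have := hpow 2
      have h3 : (m : ℝ) ^ 4 = m * m * m ^ 2 := by ring
      rw [h3]
      nlinarith [mul_pos hm0 hm0]
    rw [hexp] at h1
    have h2 := mul_le_mul_of_nonneg_right h1 (Real.exp_nonneg (-(q / 8)))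
    rw [← Real.exp_add] at h2
    have h3 : ((4 : ℕ) : ℝ) * Real.log m + -(q / 8) ≤ -(n + 2) := by push_cast; nlinarith
    have := Real.exp_le_exp.2 h3
    linarith
  have b₃ : 3 ^ m * Real.exp (-(q / 8)) ≤ Real.exp (-(n + 2)) := by
    have h1 : (3 : ℝ) ^ m ≤ Real.exp (m * 2) := by
      rw [Real.exp_nat_mul]
      refine pow_le_pow_left₀ (by norm_num) ?_ m
      linarith [Real.add_one_le_exp (2 : ℝ)]
    refine (mul_le_mul_of_nonneg_right h1 (Real.exp_nonneg _)).trans ?_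
    rw [← Real.exp_add]
    apply Real.exp_le_exp.2
    nlinarith
  have b₄ : Real.exp (-(t / 2)) ≤ Real.exp (-(n + 2)) := Real.exp_le_exp.2 (by nlinarith)
  have h4 : 4 * Real.exp (-((n : ℝ) + 2)) ≤ Real.exp (-n) := by
    have h5 : Real.exp (-(n : ℝ)) = Real.exp (-((n : ℝ) + 2)) * (Real.exp 1 * Real.exp 1) := by
      rw [← Real.exp_add, ← Real.exp_add]; congr 1; ring
    rw [h5, mul_comm]
    refine mul_le_mul_of_nonneg_left ?_ (Real.exp_nonneg _)
    nlinarith [Real.exp_one_gt_d9]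
  linarith

/-- The upper bound on the restricted isometry constant makes true decoders fail rarely. -/
theorem decode_failure_le {m k N : ℕ} {q₀ L : ℝ} (hm : 2 ≤ m) (hkm : (k : ℝ) ≤ 4 * m) (hq : 0 < q₀)
    (hq1 : q₀ ≤ 1) (hL : 1 - Real.log q₀ ≤ L) :
    N * (m * (2 * Real.exp (-(1 / (5625 * (1 / 1000 / (L * Real.log m)) ^ 2))))) ≤
      q₀ * N / (5000 * (k + 1) * m) / 4 := by
  have hl := lt_log_of_two_le hm
  have hm' : (2 : ℝ) ≤ m := by exact_mod_cast hm
  have hm0 : (0 : ℝ) < m := by linarith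
  have ha : Real.log q₀ ≤ 0 := Real.log_nonpos hq.le hq1
  have hk : (0 : ℝ) ≤ k := Nat.cast_nonneg k
  have hL0 : 0 < L := by linarith
  have hl0 : 0 < Real.log m := by linarith
  have h1 : 21 * Real.log m - Real.log q₀ ≤ 1 / (5625 * (1 / 1000 / (L * Real.log m)) ^ 2) := by
    have h2 : 1 / (5625 * (1 / 1000 / (L * Real.log m)) ^ 2)
        = 1600 / 9 * (L ^ 2 * Real.log m ^ 2) := by
      field_simp; norm_num
    rw [h2]
    have h3 : 1 - 2 * Real.log q₀ ≤ L ^ 2 := by nlinarith [sq_nonneg (Real.log q₀)]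
    have h4 : 69 / 100 * Real.log m ≤ Real.log m ^ 2 := by nlinarith
    have h5 : 47 / 100 ≤ Real.log m ^ 2 := by nlinarith
    have h6 := mul_le_mul_of_nonneg_right h3 (sq_nonneg (Real.log m))
    nlinarith
  have h2 : Real.exp (-(1 / (5625 * (1 / 1000 / (L * Real.log m)) ^ 2))) ≤ q₀ / m ^ 21 := by
    refine (Real.exp_le_exp.2 (neg_le_neg h1)).trans_eq ?_
    have h3 : (m : ℝ) ^ 21 = Real.exp (21 * Real.log m) := by
      rw [← Real.exp_log hm0, Real.log_exp, ← Real.exp_nat_mul]; norm_num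
    rw [neg_sub, Real.exp_sub, Real.exp_log hq, h3]
  have h3 : 40000 * (k + 1) * (m : ℝ) ^ 2 ≤ m ^ 21 := by
    have h4 : (2 : ℝ) ^ 18 ≤ m ^ 18 := pow_le_pow_left₀ (by norm_num) hm' 18
    have h5 : (m : ℝ) ^ 21 = m ^ 18 * m ^ 3 := by ring
    rw [h5]
    have h6 := mul_le_mul_of_nonneg_right h4 (by positivity : (0 : ℝ) ≤ m ^ 3)
    have h7 : (k + 1 : ℝ) * m ^ 2 ≤ (5 * m) * m ^ 2 :=
      mul_le_mul_of_nonneg_right (by linarith) (by positivity)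
    nlinarith [pow_pos hm0 3]
  have h4 : q₀ / (m : ℝ) ^ 21 ≤ q₀ / (40000 * (k + 1) * m ^ 2) :=
    div_le_div_of_nonneg_left hq.le (by positivity) h3
  have h5 : (N : ℝ) * (m * (2 * (q₀ / (40000 * (k + 1) * m ^ 2)))) =
      q₀ * N / (5000 * (k + 1) * m) / 4 := by
    field_simp; ring
  rw [← h5]
  gcongr
  exact h2.trans h4

end DictLearning

theorem corollary4p2 :
    ∃ c₀ c₁ c₂ c₅ c₆ : ℝ, 0 < c₀ ∧ 0 < c₁ ∧ 0 < c₂ ∧ 0 < c₅ ∧ 0 < c₆ ∧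
      ∀ (n m k N : ℕ) (q₀ η₀ κ₀ : ℝ),
        n < m → 1 ≤ k → (k : ℝ) < n / Real.log m ^ (2 * c₁) →
        0 < q₀ → q₀ ≤ 1 → 0 < η₀ → η₀ < 1 →
        κ₀ = c₀ * Real.log m ^ (-c₁) * q₀ →
        c₂ * k * n * m * (η₀ ^ 3)⁻¹ * q₀⁻¹ * Real.log m ^ c₁ * Real.log (1 / κ₀) ≤ (N : ℝ) →
        ∃ T : DictLearning.Algorithm (Fin N × Fin n) (Fin n × Fin m),
          ∀ (A : Matrix (Fin n) (Fin m) ℝ) (δ : ℝ) (S : Fin N → Finset (Fin m)),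
            δ < c₅ / (Real.log (1 / κ₀) * Real.log m ^ c₆) →
            DictLearning.IsRIP A k δ →
            (∀ r, (S r).card ≤ k) →
            (∀ i₁ i₂ i₃ : Fin m,
              q₀ * N ≤ ((Finset.univ.filter fun r : Fin N =>
                i₁ ∈ S r ∧ i₂ ∈ S r ∧ i₃ ∈ S r).card : ℝ)) →
            1 - Real.exp (-(n : ℝ)) ≤
              (DictLearning.coeffLaw S).real
                {x | DictLearning.RecoversColumns A
                  (Matrix.of fun a i => T.run (DictLearning.samples A x) (a, i)) η₀} := by
  refine ⟨Real.exp (-2), 1, 10 ^ 6, 1 / 1000, 1, Real.exp_pos _, by norm_num, by norm_num,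
    by norm_num, by norm_num, ?_⟩
  intro n m k N q₀ η₀ κ₀ hnm hk hkn hq hq1 hη hη1 hκ hN
  have hn : 1 ≤ n := by
    rcases Nat.eq_zero_or_pos n with rfl | h
    · have h1 : (1 : ℝ) ≤ k := by exact_mod_cast hk
      rw [Nat.cast_zero, zero_div] at hkn
      linarith
    · exact h
  have hm : 2 ≤ m := by omega
  have hl := DictLearning.lt_log_of_two_le hm
  have hL := DictLearning.le_log_one_div hm hq
  rw [← hκ] at hL
  have ha : Real.log q₀ ≤ 0 := Real.log_nonpos hq.le hq1
  rw [Real.rpow_one] at hN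
  simp only [Real.rpow_one]
  generalize Real.log (1 / κ₀) = L at hN hL
  have hL1 : 1 ≤ L := by linarith
  have hn' : (1 : ℝ) ≤ n := by exact_mod_cast hn
  have hk' : (1 : ℝ) ≤ k := by exact_mod_cast hk
  have hm' : (2 : ℝ) ≤ m := by exact_mod_cast hm
  have hnm' : (n : ℝ) ≤ m := by exact_mod_cast hnm.le
  have hm0 : (0 : ℝ) < m := by linarith
  have hkm : (k : ℝ) ≤ 4 * m := by
    have h1 : Real.log m ^ (2 * 1 : ℝ) = Real.log m ^ 2 := by
      rw [mul_one]; exact_mod_cast Real.rpow_natCast (Real.log m) 2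
    rw [h1, lt_div_iff₀ (by positivity)] at hkn
    have h2 : 1 / 4 ≤ Real.log m ^ 2 := by nlinarith
    nlinarith [mul_le_mul_of_nonneg_left h2 (by linarith : (0 : ℝ) ≤ k)]
  -- the sample size, in terms of `q = q₀ N`
  have hqN : 10 ^ 6 * (k * n * m * Real.log m) ≤ q₀ * N := by
    have h1 : 1 ≤ (η₀ ^ 3)⁻¹ := (one_le_inv₀ (by positivity)).2 (pow_le_one₀ hη.le hη1.le)
    have h2 : q₀ * (10 ^ 6 * k * n * m * (η₀ ^ 3)⁻¹ * q₀⁻¹ * Real.log m * L) ≤ q₀ * N :=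
      mul_le_mul_of_nonneg_left hN hq.le
    have h3 : q₀ * (10 ^ 6 * k * n * m * (η₀ ^ 3)⁻¹ * q₀⁻¹ * Real.log m * L)
        = 10 ^ 6 * (k * n * m * Real.log m) * ((η₀ ^ 3)⁻¹ * L) := by field_simp
    rw [h3] at h2
    exact (le_mul_of_one_le_right (by positivity) (one_le_mul_of_one_le_of_one_le h1 hL1)).trans h2
  have hq0 : 0 < q₀ * N := lt_of_lt_of_le (by positivity) hqN
  set t : ℝ := q₀ * N / (5000 * (k + 1) * m) with ht
  have hqt : q₀ * N = 5000 * (k + 1) * m * t := by rw [ht]; field_simp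
  have ht100 : 100 * n * Real.log m ≤ t := by
    rw [ht, le_div_iff₀ (by positivity)]
    refine le_trans ?_ hqN
    have h1 : 0 ≤ n * m * Real.log m := by positivity
    nlinarith
  have ht0 : 0 ≤ t := le_trans (by positivity) ht100
  obtain ⟨T, hT⟩ := DictLearning.exists_algorithm n m k N (400 * m ^ 2) (q₀ * N) t hm hq0 ht0
    (by rw [hqt]; exact le_of_eq (by ring))
  refine ⟨T, fun A δ S hδ hA hS h3 => ?_⟩
  have h3' : ∀ i₁ i₂ i₃, q₀ * N ≤ DictLearning.count fun r => i₁ ∈ S r ∧ i₂ ∈ S r ∧ i₃ ∈ S r := by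
    intro i₁ i₂ i₃
    refine (h3 i₁ i₂ i₃).trans_eq ?_
    unfold DictLearning.count
    congr!
  have hk2 : 2 ≤ k := by
    obtain ⟨r, h1, h2, _⟩ := DictLearning.exists_of_count_pos
      (lt_of_lt_of_le hq0 (h3' ⟨0, by omega⟩ ⟨1, by omega⟩ ⟨1, by omega⟩))
    refine le_trans ?_ (hS r)
    exact Finset.one_lt_card.2 ⟨_, h1, _, h2, by simp⟩
  have hΔ : 0 < 1 / 1000 / (L * Real.log m) := by positivity
  have hΔ1 : 1 / 1000 / (L * Real.log m) ≤ 1 := by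
    rw [div_le_one (by positivity)]
    nlinarith
  have hMk : 100 * (n * k) ≤ (((400 * m ^ 2 : ℕ) : ℕ) : ℝ) := by
    push_cast
    nlinarith [mul_le_mul hnm' hkm (by positivity) hm0.le]
  have hP := DictLearning.prob_not_typical_le (hA.mono hδ.le) hΔ hΔ1 hk2 hS h3'
    (by positivity) hMk ht0 (DictLearning.decode_failure_le hm hkm hq hq1 hL)
  have hP' := hP.trans (DictLearning.failure_sum_le hn hm ht100 hqt)
  have hadd := DictLearning.prob_add_prob_not
    (DictLearning.Typical (N := N) A S k (400 * m ^ 2) (q₀ * N) t)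
  refine le_trans ?_ ((DictLearning.prob_mono fun v hv => hT A S v hS h3' hv η₀ hη.le).trans
    (DictLearning.prob_le_coeffLaw_real S fun x => DictLearning.RecoversColumns A
      (Matrix.of fun a i => T.run (DictLearning.samples A x) (a, i)) η₀))
  linarith
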